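/- Let $\|\cdot\|$ be a strictly convex norm on $\mathbb R^2$ that is $C^1$ on $\mathbb R^2\setminus\{0\}$, with open unit ball $\mathsf B$, normalized so that $\partial\mathsf B$ has length $2\pi$, and let $\gamma\colon\mathbb R/2\pi\mathbb Z\to\partial\mathsf B$ be a counterclockwise arc-length parametrization of $\partial\mathsf B$. For an open set $U\subset\mathbb R^2$, $\varepsilon>0$ and $v\in W^{1,2}(U;\mathbb R^2)$ put $$I_\varepsilon(v;U)=\int_U\Big(\varepsilon|\nabla v|^2+\frac1\varepsilon\big(1-\|v\|^2\big)^2\Big)\,dx\in[0,\infty].$$ Let $\mathrm{ENT}$ be the set of maps $\Phi\in C^1(\partial\mathsf B;\mathbb R^2)$ such that $\frac{d}{d\theta}\Phi(\gamma(\theta))=\lambda_\Phi(\theta)\gamma'(\theta)$ for some function $\lambda_\Phi\in C^1(\mathbb R/2\pi\mathbb Z)$. There is a constant $C_0>0$ depending only on $\mathsf B$ with the following property. Let $\Omega\subset\mathbb R^2$ be a bounded open set, let $\varepsilon_n>0$ with $\varepsilon_n\to0$, and let $m\colon\Omega\to\mathbb R^2$ be the limit in $L^2(\Omega)$ of a sequence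 $(m_n)\subset W^{1,2}(\Omega;\mathbb R^2)$ with $\nabla\cdot m_n=0$ in $\mathcal D'(\Omega)$ for all $n$ and $\sup_n I_{\varepsilon_n}(m_n;\Omega)<\infty$. Then: 1. $m$ solves the generalized Eikonal equation: $\|m\|=1$ a.e. in $\Omega$ and $\nabla\cdot m=0$ in $\mathcal D'(\Omega)$. 2. For every $\Phi\in\mathrm{ENT}$ the distribution $\nabla\cdot\Phi(m)$ is a finite (signed) Radon measure on $\Omega$. 3. For every open set $U\subset\Omega$, $$\Big(\bigvee_{\Phi\in\mathrm{ENT},\ \|\lambda_\Phi'\|_\infty\le1}|\nabla\cdot\Phi(m)|\Big)(U)\le C_0\,\liminf_{n\to\infty}I_{\varepsilon_n}(m_n;U),$$ where $|\mu|$ is the total variation measure of $\mu$ and $\bigvee$ denotes the lowest upper bound measure of a family of positive measures, i.e. the smallest positive measure that is larger than or equal to all of them. -/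

import Mathlib

open MeasureTheory Filter Topology TopologicalSpace Distributions
open scoped ENNReal

/-- The Euclidean plane `ℝ²`. -/
abbrev Plane : Type := EuclideanSpace ℝ (Fin 2)

/-- The seminorm `N` is a strictly convex norm on `ℝ²` that is `C¹` away from the origin. -/
structure IsStrictlyConvexC1Norm (N : Seminorm ℝ Plane) : Prop where
  eq_zero_of_map_eq_zero : ∀ z, N z = 0 → z = 0
  strictConvex : StrictConvex ℝ {z | N z ≤ 1}
  contDiffOn : ContDiffOn ℝ 1 N {0}ᶜ

/-- `γ`, viewed as a `2π`-periodic map on `ℝ`, is a counterclockwise arc-length parametrization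
of the unit circle `∂B = {z | N z = 1}` of the norm `N`; in particular `∂B` has length `2π`. -/
structure IsArcLengthParam (N : Seminorm ℝ Plane) (γ : ℝ → Plane) : Prop where
  contDiff : ContDiff ℝ 1 γ
  periodic : Function.Periodic γ (2 * Real.pi)
  injOn : Set.InjOn γ (Set.Ico 0 (2 * Real.pi))
  range_eq : Set.range γ = {z | N z = 1}
  norm_deriv : ∀ θ, ‖deriv γ θ‖ = 1
  counterclockwise : ∀ θ, 0 < γ θ 0 * deriv γ θ 1 - γ θ 1 * deriv γ θ 0

/-- `G j` is the weak partial derivative `∂ⱼ v` in `Ω`, for `j = 0, 1`. -/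
def HasWeakGradient (Ω : Opens Plane) (v : Plane → Plane) (G : Fin 2 → Plane → Plane) : Prop :=
  ∀ (j : Fin 2) (φ : 𝓓(Ω, ℝ)),
    ∫ x in Ω, fderiv ℝ φ x (EuclideanSpace.single j 1) • v x = -∫ x in Ω, φ x • G j x

/-- `v ∈ W^{1,2}(Ω; ℝ²)`, with weak gradient `G = (∂₀ v, ∂₁ v)`. Only the values in `Ω` matter. -/
structure IsW12 (Ω : Opens Plane) (v : Plane → Plane) (G : Fin 2 → Plane → Plane) : Prop where
  memLp : MemLp v 2 (volume.restrict Ω)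
  memLp_grad : ∀ j, MemLp (G j) 2 (volume.restrict Ω)
  hasWeakGradient : HasWeakGradient Ω v G

/-- `∇ · v = 0` in the sense of distributions on `Ω`. -/
def DivFree (Ω : Opens Plane) (v : Plane → Plane) : Prop :=
  ∀ φ : 𝓓(Ω, ℝ), ∫ x in Ω, fderiv ℝ φ x (v x) = 0

/-- The generalized Aviles-Giga energy
`I_ε(v; U) = ∫_U (ε |∇v|² + ε⁻¹ (1 - N(v)²)²) dx ∈ [0, ∞]` of a map `v` with weak gradient `G`;
here `|∇v|` is the Euclidean (Frobenius) norm of the gradient. -/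
noncomputable def energy (N : Seminorm ℝ Plane) (ε : ℝ) (v : Plane → Plane)
    (G : Fin 2 → Plane → Plane) (U : Opens Plane) : ℝ≥0∞ :=
  ∫⁻ x in U, ENNReal.ofReal (ε * ∑ j, ‖G j x‖ ^ 2 + 1 / ε * (1 - N (v x) ^ 2) ^ 2)

/-- `m` solves the generalized Eikonal equation: `N(m) = 1` a.e. in `Ω` and `∇ · m = 0` in the
sense of distributions on `Ω`. -/
def SolvesEikonal (N : Seminorm ℝ Plane) (Ω : Opens Plane) (m : Plane → Plane) : Prop :=
  (∀ᵐ x ∂(volume.restrict (Ω : Set Plane)), N (m x) = 1) ∧ DivFree Ω m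

/-- The restriction of `Φ` to the curve parametrized by `γ` is a `C¹` map such that
`d/dθ Φ(γ(θ)) = lam(θ) γ'(θ)`, with `lam` a `2π`-periodic `C¹` function. Only the values of `Φ`
on the curve matter. -/
structure IsEntropyWith (γ : ℝ → Plane) (Φ : Plane → Plane) (lam : ℝ → ℝ) : Prop where
  contDiff_comp : ContDiff ℝ 1 (fun θ => Φ (γ θ))
  contDiff_coeff : ContDiff ℝ 1 lam
  periodic_coeff : Function.Periodic lam (2 * Real.pi)
  hasDerivAt : ∀ θ, HasDerivAt (fun t => Φ (γ t)) (lam θ • deriv γ θ) θ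

/-- The class `ENT` of entropies. -/
def ENT (γ : ℝ → Plane) : Set (Plane → Plane) :=
  {Φ | ∃ lam, IsEntropyWith γ Φ lam}

/-- The entropies `Φ ∈ ENT` whose coefficient `lam = λ_Φ` satisfies `‖λ_Φ'‖_∞ ≤ 1`. -/
def unitENT (γ : ℝ → Plane) : Set (Plane → Plane) :=
  {Φ | ∃ lam, IsEntropyWith γ Φ lam ∧ ∀ θ, |deriv lam θ| ≤ 1}

/-- The distribution `∇ · F` on `Ω` is the finite signed Radon measure `μ`, i.e.
`-∫_Ω F · ∇φ dx = ∫ φ dμ` for all test functions `φ`. A finite signed measure on `Ω` is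
represented by its extension by zero to the plane, hence the first condition, which makes `μ`
unique. -/
def DivEqMeasure (Ω : Opens Plane) (F : Plane → Plane) (μ : SignedMeasure Plane) : Prop :=
  μ.totalVariation (Ω : Set Plane)ᶜ = 0 ∧
  ∀ φ : 𝓓(Ω, ℝ), -∫ x in Ω, fderiv ℝ φ x (F x) =
    ∫ x, φ x ∂μ.toJordanDecomposition.posPart - ∫ x, φ x ∂μ.toJordanDecomposition.negPart

/-- The lowest upper bound measure of the family `|∇ · Φ(m)|`, where `Φ` ranges over the entropies
with `‖λ_Φ'‖_∞ ≤ 1`: the supremum in the complete lattice of positive measures. -/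
noncomputable def lubEntropyProduction (γ : ℝ → Plane) (Ω : Opens Plane) (m : Plane → Plane) :
    Measure Plane :=
  sSup {ν | ∃ Φ ∈ unitENT γ, ∃ μ : SignedMeasure Plane,
    DivEqMeasure Ω (fun x => Φ (m x)) μ ∧ ν = μ.totalVariation}

/-!
The proof rests on a good extension of entropies to the plane. Write `z = r γ(θ)` in polar
coordinates. If `d/dθ Φ(γ(θ)) = λ(θ) γ'(θ)`, put, near the unit circle `r = 1`,
`F(z) = Φ(γ(θ)) + (r - 1) λ(θ) γ(θ)`. Then `∂_r F = λ γ` and `∂_θ F = λ (r γ') + (r - 1) λ' γ`,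
that is,
`DF = λ Id + (r - 1) λ' γ ⊗ ∇θ`. Only `λ'`, and no second derivative of `γ`, enters here. Hence for a
divergence free map `v ∈ W^{1,2}`, the term `λ Id` does not contribute to `∇ · F(v)`, and
`|∇ · F(v)| ≤ C ‖λ'‖_∞ |N(v) - 1| |∇v|`, which is at most the energy density by Young's inequality.
Away from the circle `F` is cut off; the resulting error terms contain `λ` and `Φ`, which are
bounded by `‖λ'‖_∞` once an affine map `z ↦ c z + p` has been subtracted from `Φ`. This does not
change `∇ · Φ(m)`, since `m` is divergence free. The extension is constructed in
`IsEntropyWith.exists_extension`. Its smoothness comes from the inverse function theorem for polar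
coordinates, and its constants from the fact that the tangent lines of the unit circle stay away
from the origin (`IsArcLengthParam.one_le_mul_cross`). The bound on `∇ · F(v)` is proved for smooth
maps and then for `W^{1,2}` maps by mollification in `abs_integral_fderiv_comp_le`.

Since `F = Φ - c z - p` on the unit circle, passing to the limit gives
`|⟨∇ · Φ(m), φ⟩| ≤ C ‖λ'‖_∞ ∫ |φ| dν` for every weak limit `ν` of the energy densities. Such limits
are taken along ultrafilters, by the Riesz-Markov-Kakutani theorem (`exists_weak_limit`). A
distribution bounded in this way is a signed measure (`exists_signedMeasure_of_abs_le`), and its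
total variation is at most `C ‖λ'‖_∞ ν` (`totalVariation_restrict_le`). As `ν` does not depend on
`Φ`, it also bounds the supremum of the total variations (`sSup_measure_apply_le`). Finally, for any
given open set `U` and any `c` larger than the lower limit of the energies on `U`, the ultrafilter
can be chosen such that `ν(U) ≤ c`.
-/

/-! ### Plane geometry and polar coordinates of a norm -/

/-- The determinant `v₀ w₁ - v₁ w₀` of two vectors of the plane. -/
def cross (v w : Plane) : ℝ := v 0 * w 1 - v 1 * w 0

lemma norm_sq_eq_coord (v : Plane) : ‖v‖ ^ 2 = v 0 ^ 2 + v 1 ^ 2 := by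
  rw [EuclideanSpace.norm_sq_eq]; simp

lemma abs_coord_le_norm (v : Plane) (j : Fin 2) : |v j| ≤ ‖v‖ := by
  simpa using PiLp.norm_apply_le v j

lemma abs_cross_le (v w : Plane) : |cross v w| ≤ ‖v‖ * ‖w‖ := by
  apply abs_le_of_sq_le_sq _ (by positivity)
  rw [mul_pow, norm_sq_eq_coord, norm_sq_eq_coord, cross]
  nlinarith [sq_nonneg (v 0 * w 0 + v 1 * w 1)]

/-- Cramer's rule in the plane. -/
lemma cross_smul_eq (a b w : Plane) :
    cross a b • w = cross w b • a + cross a w • b := by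
  ext i
  fin_cases i <;> simp [cross] <;> ring

lemma exists_seminorm_le_mul_norm (N : Seminorm ℝ Plane) : ∃ L : ℝ, 0 < L ∧ ∀ z, N z ≤ L * ‖z‖ := by
  refine ⟨N (EuclideanSpace.single 0 1) + N (EuclideanSpace.single 1 1) + 1, by positivity,
    fun z => ?_⟩
  have hz : z = z 0 • EuclideanSpace.single 0 1 + z 1 • EuclideanSpace.single 1 1 := by
    ext i; fin_cases i <;> simp
  calc N z ≤ N (z 0 • EuclideanSpace.single 0 1) + N (z 1 • EuclideanSpace.single 1 1) := by
        conv_lhs => rw [hz]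
        exact map_add_le_add N _ _
    _ = |z 0| * N (EuclideanSpace.single 0 1) + |z 1| * N (EuclideanSpace.single 1 1) := by
        simp [map_smul_eq_mul]
    _ ≤ ‖z‖ * N (EuclideanSpace.single 0 1) + ‖z‖ * N (EuclideanSpace.single 1 1) := by
        gcongr <;> exact abs_coord_le_norm z _
    _ ≤ _ := by nlinarith [norm_nonneg z]

lemma abs_seminorm_sub_le {N : Seminorm ℝ Plane} {L : ℝ} (hL : ∀ z, N z ≤ L * ‖z‖) (x y : Plane) :
    |N x - N y| ≤ L * ‖x - y‖ :=
  (abs_sub_map_le_sub N x y).trans (hL _)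

lemma lipschitzWith_seminorm {N : Seminorm ℝ Plane} {L : ℝ} (hL : ∀ z, N z ≤ L * ‖z‖) :
    LipschitzWith L.toNNReal N := by
  apply LipschitzWith.of_dist_le_mul
  intro x y
  rw [Real.dist_eq, dist_eq_norm]
  exact (abs_seminorm_sub_le hL x y).trans (by gcongr; exact Real.le_coe_toNNReal L)

lemma continuous_seminorm_plane (N : Seminorm ℝ Plane) : Continuous N := by
  obtain ⟨L, -, hL⟩ := exists_seminorm_le_mul_norm N
  exact (lipschitzWith_seminorm hL).continuous

namespace IsStrictlyConvexC1Norm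

variable {N : Seminorm ℝ Plane}

lemma exists_norm_le_mul (hN : IsStrictlyConvexC1Norm N) :
    ∃ R : ℝ, 0 < R ∧ ∀ z, ‖z‖ ≤ R * N z := by
  have hne : (Metric.sphere (0 : Plane) 1).Nonempty :=
    ⟨EuclideanSpace.single 0 1, by simp⟩
  obtain ⟨z₀, hz₀, hmin⟩ := (isCompact_sphere (0 : Plane) 1).exists_isMinOn hne
    (continuous_seminorm_plane N).continuousOn
  have hpos : 0 < N z₀ := by
    refine lt_of_le_of_ne (apply_nonneg N z₀) fun h => ?_
    have := hN.eq_zero_of_map_eq_zero z₀ h.symm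
    simp [this] at hz₀
  refine ⟨(N z₀)⁻¹, inv_pos.2 hpos, fun z => ?_⟩
  rcases eq_or_ne z 0 with rfl | hz
  · simp
  have hz' : 0 < ‖z‖ := norm_pos_iff.2 hz
  have h1 : N z₀ ≤ N (‖z‖⁻¹ • z) := hmin (by simp [norm_smul, hz'.ne'])
  rw [map_smul_eq_mul, norm_inv, norm_norm] at h1
  rw [le_inv_mul_iff₀ hpos]
  rw [le_inv_mul_iff₀ hz'] at h1
  linarith

end IsStrictlyConvexC1Norm

namespace IsArcLengthParam

variable {N : Seminorm ℝ Plane} {γ : ℝ → Plane}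

lemma map_eq_one (hγ : IsArcLengthParam N γ) (θ : ℝ) : N (γ θ) = 1 := by
  have : γ θ ∈ Set.range γ := ⟨θ, rfl⟩
  rwa [hγ.range_eq] at this

lemma exists_eq (hγ : IsArcLengthParam N γ) {z : Plane} (hz : N z = 1) : ∃ θ, γ θ = z := by
  have : z ∈ Set.range γ := by rw [hγ.range_eq]; exact hz
  exact this

lemma hasDerivAt (hγ : IsArcLengthParam N γ) (θ : ℝ) : HasDerivAt γ (deriv γ θ) θ :=
  (hγ.contDiff.differentiable one_ne_zero θ).hasDerivAt

lemma exists_polar (hγ : IsArcLengthParam N γ) {z : Plane} (hz : N z ≠ 0) :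
    ∃ θ, z = N z • γ θ := by
  obtain ⟨θ, hθ⟩ := hγ.exists_eq (z := (N z)⁻¹ • z) (by
    rw [map_smul_eq_mul, norm_inv, Real.norm_of_nonneg (apply_nonneg N z), inv_mul_cancel₀ hz])
  exact ⟨θ, by rw [hθ, smul_inv_smul₀ hz]⟩

lemma map_smul_eq (hγ : IsArcLengthParam N γ) {r : ℝ} (hr : 0 ≤ r) (θ : ℝ) :
    N (r • γ θ) = r := by
  rw [map_smul_eq_mul, hγ.map_eq_one, Real.norm_of_nonneg hr, mul_one]

/-- The number `cross (γ θ) (γ' θ)` is the distance from the origin to the tangent line of the unit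
circle at `γ θ`. It is bounded below by the inradius: the differential `p` of `N` at `γ θ`
satisfies `p (γ θ) = 1` and `p (γ' θ) = 0`, and has norm at most the Lipschitz constant of `N`. -/
lemma one_le_mul_cross (hN : IsStrictlyConvexC1Norm N) (hγ : IsArcLengthParam N γ) {L : ℝ}
    (hL0 : 0 < L) (hL : ∀ z, N z ≤ L * ‖z‖) (θ : ℝ) :
    1 ≤ L * cross (γ θ) (deriv γ θ) := by
  have hne : γ θ ∈ ({0}ᶜ : Set Plane) := by
    intro h
    have h0 : γ θ = 0 := h
    have h1 := hγ.map_eq_one θ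
    rw [h0, map_zero] at h1
    exact zero_ne_one h1
  have hd : DifferentiableAt ℝ N (γ θ) :=
    ((hN.contDiffOn.contDiffAt (isOpen_compl_singleton.mem_nhds hne)).differentiableAt one_ne_zero)
  set p := fderiv ℝ N (γ θ) with hp
  have hpγ' : p (deriv γ θ) = 0 := by
    have h1 : HasDerivAt (fun t => N (γ t)) (p (deriv γ θ)) θ :=
      hd.hasFDerivAt.comp_hasDerivAt θ (hγ.hasDerivAt θ)
    have h2 : (fun t => N (γ t)) = fun _ => (1 : ℝ) := funext hγ.map_eq_one
    rw [h2] at h1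
    exact h1.unique (hasDerivAt_const θ 1)
  have hpγ : p (γ θ) = 1 := by
    have h0 : HasDerivAt (fun r : ℝ => r • γ θ) (γ θ) 1 := by
      simpa using (hasDerivAt_id (1 : ℝ)).smul_const (γ θ)
    have h1 : HasDerivAt (fun r : ℝ => N (r • γ θ)) (p (γ θ)) 1 :=
      HasFDerivAt.comp_hasDerivAt (1 : ℝ) (by rw [one_smul]; exact hd.hasFDerivAt) h0
    have h2 : HasDerivAt (fun r : ℝ => N (r • γ θ)) 1 1 := by
      refine (hasDerivAt_id (1 : ℝ)).congr_of_eventuallyEq ?_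
      filter_upwards [lt_mem_nhds (zero_lt_one' ℝ)] with r hr
      simpa using hγ.map_smul_eq hr.le θ
    exact h1.unique h2
  -- test the differential on the unit normal `w` of the curve
  set w : Plane := !₂[deriv γ θ 1, -deriv γ θ 0] with hw
  have hγ'sq : deriv γ θ 0 ^ 2 + deriv γ θ 1 ^ 2 = 1 := by
    rw [← norm_sq_eq_coord, hγ.norm_deriv, one_pow]
  have hwn : ‖w‖ = 1 := by
    have : ‖w‖ ^ 2 = 1 := by
      rw [norm_sq_eq_coord]; simp [hw]; linarith
    nlinarith [norm_nonneg w]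
  have hwc : cross w (deriv γ θ) = 1 := by
    simp [cross, hw]; linarith
  have h3 := congrArg p (cross_smul_eq (γ θ) (deriv γ θ) w)
  simp only [map_add, map_smul, hpγ, hpγ', smul_eq_mul, hwc] at h3
  have h4 : p w ≤ L := by
    have : ‖p‖ ≤ L := by
      have := norm_fderiv_le_of_lipschitz ℝ (lipschitzWith_seminorm hL) (x₀ := γ θ)
      rwa [Real.coe_toNNReal L hL0.le] at this
    calc p w ≤ ‖p w‖ := le_abs_self _
      _ ≤ ‖p‖ * ‖w‖ := p.le_opNorm w
      _ ≤ L := by rw [hwn, mul_one]; exact this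
  have h5 : 0 < cross (γ θ) (deriv γ θ) := hγ.counterclockwise θ
  nlinarith

/-- A map of the plane is `C¹` away from the origin as soon as it is `C¹` in the polar coordinates
`(r, θ) ↦ r γ(θ)`, by the inverse function theorem. The derivatives are related by the chain
rule. -/
lemma contDiffAt_of_polar (hγ : IsArcLengthParam N γ) {F : Plane → Plane} {H : ℝ × ℝ → Plane}
    (hFH : ∀ r θ, 0 < r → F (r • γ θ) = H (r, θ)) (hH : ContDiff ℝ 1 H) {r θ : ℝ} (hr : 0 < r) :
    ContDiffAt ℝ 1 F (r • γ θ) := by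
  set P : ℝ × ℝ → Plane := fun q => q.1 • γ q.2 with hP
  have hPc : ContDiff ℝ 1 P := contDiff_fst.smul (hγ.contDiff.comp contDiff_snd)
  have hdP : HasFDerivAt P (fderiv ℝ P (r, θ)) (r, θ) :=
    (hPc.differentiable one_ne_zero _).hasFDerivAt
  have hcr := hγ.counterclockwise θ
  have hval : ∀ a b : ℝ, fderiv ℝ P (r, θ) (a, b) = a • γ θ + (b * r) • deriv γ θ := by
    intro a b
    have h1 : HasFDerivAt (fun q : ℝ × ℝ => q.1) (ContinuousLinearMap.fst ℝ ℝ ℝ) (r, θ) :=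
      hasFDerivAt_fst
    have h2 : HasFDerivAt (fun q : ℝ × ℝ => γ q.2) _ (r, θ) :=
      (hγ.hasDerivAt θ).hasFDerivAt.comp (r, θ) hasFDerivAt_snd
    have h3 := h1.smul h2
    have h4 := hdP.unique h3
    rw [h4]
    simp [smul_smul, mul_comm, add_comm]
  have hinj : Function.Injective (fderiv ℝ P (r, θ)) := by
    rw [injective_iff_map_eq_zero]
    rintro ⟨a, b⟩ hab
    rw [hval] at hab
    have e0 := congrArg (fun z : Plane => z 0) hab
    have e1 := congrArg (fun z : Plane => z 1) hab
    simp only [PiLp.add_apply, PiLp.smul_apply, smul_eq_mul, PiLp.zero_apply] at e0 e1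
    have ha : a * (γ θ 0 * deriv γ θ 1 - γ θ 1 * deriv γ θ 0) = 0 := by
      linear_combination deriv γ θ 1 * e0 - deriv γ θ 0 * e1
    have hb : (b * r) * (γ θ 0 * deriv γ θ 1 - γ θ 1 * deriv γ θ 0) = 0 := by
      linear_combination γ θ 0 * e1 - γ θ 1 * e0
    have ha' : a = 0 := by simpa [hcr.ne'] using ha
    have hb' : b = 0 := by simpa [hcr.ne', hr.ne'] using hb
    simp [ha', hb']
  have hrank : Module.finrank ℝ (ℝ × ℝ) = Module.finrank ℝ Plane := by simp
  let e : (ℝ × ℝ) ≃L[ℝ] Plane := (LinearEquiv.ofInjectiveOfFinrankEq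
    (fderiv ℝ P (r, θ) : ℝ × ℝ →ₗ[ℝ] Plane) hinj hrank).toContinuousLinearEquiv
  have he : (e : ℝ × ℝ →L[ℝ] Plane) = fderiv ℝ P (r, θ) := by
    refine ContinuousLinearMap.ext fun x => ?_
    exact LinearMap.congr_fun (LinearEquiv.coe_ofInjectiveOfFinrankEq
      (fderiv ℝ P (r, θ) : ℝ × ℝ →ₗ[ℝ] Plane) hinj hrank) x
  have hdP' : HasFDerivAt P (e : ℝ × ℝ →L[ℝ] Plane) (r, θ) := by rw [he]; exact hdP
  have hq := hPc.contDiffAt.to_localInverse hdP' one_ne_zero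
  set q := hPc.contDiffAt.localInverse hdP' one_ne_zero with hqdef
  have hq0 : q (P (r, θ)) = (r, θ) := hPc.contDiffAt.localInverse_apply_image hdP' one_ne_zero
  have hright : ∀ᶠ y in 𝓝 (P (r, θ)), P (q y) = y :=
    (hPc.contDiffAt.hasStrictFDerivAt' hdP' one_ne_zero).eventually_right_inverse
  have hpos : ∀ᶠ y in 𝓝 (P (r, θ)), 0 < (q y).1 := by
    have : ContinuousAt (fun y => (q y).1) (P (r, θ)) := hq.continuousAt.fst
    refine this.eventually (lt_mem_nhds ?_)
    simpa [hq0] using hr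
  have hEq : F =ᶠ[𝓝 (P (r, θ))] fun y => H (q y) := by
    filter_upwards [hright, hpos] with y h1 h2
    conv_lhs => rw [← h1]
    exact hFH _ _ h2
  have : ContDiffAt ℝ 1 (fun y => H (q y)) (P (r, θ)) := hH.contDiffAt.comp _ hq
  exact this.congr_of_eventuallyEq hEq

end IsArcLengthParam

/-! ### Extension of entropies to the plane -/

/-- A `C¹` cutoff which is stationary to first order at `1`. -/
lemma exists_cutoff : ∃ (χ : ℝ → ℝ) (M : ℝ), 0 < M ∧ ContDiff ℝ 1 χ ∧ χ 1 = 1 ∧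
    (∀ r, 0 ≤ χ r ∧ χ r ≤ 1) ∧ (∀ r, 1 / 2 ≤ |r - 1| → χ r = 0) ∧
    (∀ r, 1 / 2 < |r - 1| → deriv χ r = 0) ∧ ∀ r, |deriv χ r| ≤ M * min |r - 1| 1 := by
  let f : ContDiffBump (1 : ℝ) := ⟨1 / 4, 1 / 2, by norm_num, by norm_num⟩
  have hf : ContDiff ℝ 1 f := f.contDiff
  have hzero : ∀ r, 1 / 2 ≤ |r - 1| → f r = 0 := fun r hr =>
    f.zero_of_le_dist (by rw [Real.dist_eq]; exact hr)
  obtain ⟨M, hM⟩ := (hf.continuous_deriv le_rfl).bounded_above_of_compact_support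
    f.hasCompactSupport.deriv
  have hM0 : 0 ≤ M := (norm_nonneg _).trans (hM 0)
  refine ⟨f, 4 * M + 1, by positivity, hf, f.one_of_mem_closedBall (by simp [f.rIn_pos.le]),
    fun r => ⟨f.nonneg, f.le_one⟩, hzero, fun r hr => ?_, fun r => ?_⟩
  · have : (f : ℝ → ℝ) =ᶠ[𝓝 r] fun _ => 0 := by
      have : ∀ᶠ s in 𝓝 r, 1 / 2 < |s - 1| :=
        (continuous_abs.comp (continuous_id.sub continuous_const)).continuousAt.eventually
          (lt_mem_nhds hr)
      filter_upwards [this] with s hs using hzero s hs.le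
    rw [this.deriv_eq, deriv_const]
  · rcases lt_or_ge |r - 1| (1 / 4) with h | h
    · have : (f : ℝ → ℝ) =ᶠ[𝓝 r] fun _ => 1 :=
        f.eventuallyEq_one_of_mem_ball (by rw [Metric.mem_ball, Real.dist_eq]; exact h)
      rw [this.deriv_eq, deriv_const, abs_zero]
      positivity
    · have h1 : (1 : ℝ) / 4 ≤ min |r - 1| 1 := le_min h (by norm_num)
      have h2 := hM r
      rw [Real.norm_eq_abs] at h2
      nlinarith

lemma exists_mem_Ico_two_pi (θ : ℝ) :
    ∃ t ∈ Set.Ico 0 (2 * Real.pi), ∃ k : ℤ, θ = t + k * (2 * Real.pi) := by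
  refine ⟨toIcoMod Real.two_pi_pos 0 θ, ?_, toIcoDiv Real.two_pi_pos 0 θ, ?_⟩
  · simpa only [zero_add] using toIcoMod_mem_Ico Real.two_pi_pos 0 θ
  · simp

lemma norm_sub_zero_le_of_periodic {E : Type*} [NormedAddCommGroup E] [NormedSpace ℝ E]
    {f : ℝ → E} {Λ : ℝ} (hf : Differentiable ℝ f) (hper : Function.Periodic f (2 * Real.pi))
    (hΛ : ∀ θ, ‖deriv f θ‖ ≤ Λ) (θ : ℝ) : ‖f θ - f 0‖ ≤ 2 * Real.pi * Λ := by
  have hΛ0 : 0 ≤ Λ := (norm_nonneg _).trans (hΛ 0)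
  obtain ⟨t, ht, k, rfl⟩ := exists_mem_Ico_two_pi θ
  rw [hper.int_mul k t]
  have := convex_univ.norm_image_sub_le_of_norm_deriv_le (f := f) (C := Λ)
    (fun x _ => hf x) (fun x _ => hΛ x) (Set.mem_univ 0) (Set.mem_univ t)
  rw [sub_zero, Real.norm_of_nonneg ht.1] at this
  nlinarith [ht.2]

namespace IsArcLengthParam

variable {N : Seminorm ℝ Plane} {γ : ℝ → Plane}

/-- A `2π`-periodic function of the parameter is a function of the point of the curve. -/
lemma factorsThrough (hγ : IsArcLengthParam N γ) {lam : ℝ → ℝ}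
    (hlam : Function.Periodic lam (2 * Real.pi)) : Function.FactorsThrough lam γ := by
  intro s t hst
  obtain ⟨s', hs', k, rfl⟩ := exists_mem_Ico_two_pi s
  obtain ⟨t', ht', l, rfl⟩ := exists_mem_Ico_two_pi t
  rw [hγ.periodic.int_mul k s', hγ.periodic.int_mul l t'] at hst
  rw [hlam.int_mul k s', hlam.int_mul l t', hγ.injOn hs' ht' hst]

end IsArcLengthParam

namespace IsEntropyWith

variable {N : Seminorm ℝ Plane} {γ : ℝ → Plane} {Φ : Plane → Plane} {lam : ℝ → ℝ}

/-- Subtracting from an entropy an affine map `z ↦ c z + p` subtracts `c` from its coefficient. -/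
lemma sub_affine (hγ : IsArcLengthParam N γ) (h : IsEntropyWith γ Φ lam) (c : ℝ) (p : Plane) :
    IsEntropyWith γ (fun z => Φ z - c • z - p) (fun θ => lam θ - c) where
  contDiff_comp := by
    have h1 : ContDiff ℝ 1 (fun θ => c • γ θ) := hγ.contDiff.const_smul c
    exact (h.contDiff_comp.sub h1).sub contDiff_const
  contDiff_coeff := h.contDiff_coeff.sub contDiff_const
  periodic_coeff θ := by simp only [h.periodic_coeff θ]
  hasDerivAt θ := by
    have h1 : HasDerivAt (fun t => c • γ t) (c • deriv γ θ) θ := (hγ.hasDerivAt θ).const_smul c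
    have h2 : HasDerivAt (fun t => Φ (γ t) - c • γ t - p)
        (lam θ • deriv γ θ - c • deriv γ θ) θ := ((h.hasDerivAt θ).sub h1).sub_const p
    rw [sub_smul]
    exact h2

/-- The estimate of the differential of the extension, in terms of the values `D γ`, `D γ'` of the
differential at the point `r γ(θ)`. Here `x`, `d` are the values at `r` of the cutoff and its
derivative, `y` is the value of the entropy, and `l`, `l'` are those of its coefficient and
the derivative of the coefficient. -/
lemma norm_polar_sub_smul_le {L R M Λ Λ₁ Λ₂ : ℝ} (hN : IsStrictlyConvexC1Norm N)
    (hL0 : 0 < L) (hL : ∀ z, N z ≤ L * ‖z‖) (hR0 : 0 < R) (hR : ∀ z, ‖z‖ ≤ R * N z) (hM0 : 0 < M)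
    (hγ : IsArcLengthParam N γ) {r θ x d l l' : ℝ} {y : Plane} (hr0 : 0 < r)
    (hx01 : 0 ≤ x ∧ x ≤ 1) (hχ0 : 1 / 2 ≤ |r - 1| → x = 0) (hχ'0 : 1 / 2 < |r - 1| → d = 0)
    (hd : |d| ≤ M * min |r - 1| 1) (hl' : |l'| ≤ Λ) (hl : |l| ≤ Λ₁) (hy : ‖y‖ ≤ Λ₂)
    (D : Plane →L[ℝ] Plane)
    (hDr : D (γ θ) = d • y + ((x + (r - 1) * d) * l) • γ θ)
    (hDθ : r • D (deriv γ θ) = (x * l) • deriv γ θ +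
        ((r - 1) * x) • (l' • γ θ + l • deriv γ θ)) (w : Plane) :
    ‖D w - ((x + (r - 1) * d) * l) • w‖ ≤
        L * (M * Λ₂ + R * M * Λ₁ + 2 * R ^ 2 * Λ) * min |r - 1| 1 * ‖w‖ := by
  have hΛ₂0 : 0 ≤ Λ₂ := (norm_nonneg _).trans hy
  have hΛ₁0 : 0 ≤ Λ₁ := (abs_nonneg _).trans hl
  have hΛ0 : 0 ≤ Λ := (abs_nonneg _).trans hl'
  have hc0 : 0 < cross (γ θ) (deriv γ θ) := hγ.counterclockwise θ
  have hcL := hγ.one_le_mul_cross hN hL0 hL θ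
  set c := cross (γ θ) (deriv γ θ) with hc
  set a := cross w (deriv γ θ) / c with ha
  set b := cross (γ θ) w / c with hb
  have hw : w = a • γ θ + b • deriv γ θ := by
    have := cross_smul_eq (γ θ) (deriv γ θ) w
    rw [← hc] at this
    rw [ha, hb, div_eq_inv_mul, div_eq_inv_mul, mul_smul, mul_smul, ← smul_add, ← this,
      inv_smul_smul₀ hc0.ne']
  have hγn : ‖γ θ‖ ≤ R := by simpa [hγ.map_eq_one θ] using hR (γ θ)
  have hdiv : ∀ x B : ℝ, |x| ≤ B → |x / c| ≤ L * B := by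
    intro x B hx
    rw [abs_div, abs_of_pos hc0, div_le_iff₀ hc0]
    nlinarith [(abs_nonneg x).trans hx]
  have hale : |a| ≤ L * ‖w‖ := hdiv _ _ (by
    simpa [hγ.norm_deriv] using abs_cross_le w (deriv γ θ))
  have hble : |b| ≤ L * (R * ‖w‖) := hdiv _ _
    ((abs_cross_le (γ θ) w).trans (by gcongr))
  have hDθ' : D (deriv γ θ) = r⁻¹ • ((x * l) • deriv γ θ +
      ((r - 1) * x) • (l' • γ θ + l • deriv γ θ)) := by
    rw [← hDθ, inv_smul_smul₀ hr0.ne']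
  have key : D w - ((x + (r - 1) * d) * l) • w =
      (a * d) • y + (-(b * ((r - 1) * d) * l)) • deriv γ θ +
        (b * (r⁻¹ * ((r - 1) * x)) * l') • γ θ := by
    conv_lhs => rw [hw]
    rw [map_add, map_smul, map_smul, hDr, hDθ']
    match_scalars <;> field_simp <;> ring
  set g := min |r - 1| 1 with hg
  have hg0 : 0 ≤ g := by positivity
  have hχ'2 : |(r - 1) * d| ≤ M * g := by
    rw [abs_mul]
    rcases le_or_gt |r - 1| (1 / 2) with h1 | h1
    · have := hd
      nlinarith [abs_nonneg (r - 1), abs_nonneg (d)]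
    · rw [hχ'0 h1, abs_zero, mul_zero]; positivity
  have hχ3 : |r⁻¹ * ((r - 1) * x)| ≤ 2 * g := by
    rcases lt_or_ge |r - 1| (1 / 2) with h1 | h1
    · have h2 : g = |r - 1| := min_eq_left (by linarith)
      have h3 : 1 / 2 ≤ r := by have := (abs_lt.1 h1).1; linarith
      have h4 : r⁻¹ ≤ 2 := by
        rw [inv_le_comm₀ hr0 (by norm_num)]; linarith
      rw [abs_mul, abs_mul, abs_of_pos (inv_pos.2 hr0), abs_of_nonneg hx01.1, h2]
      have h5 : |r - 1| * x ≤ |r - 1| := mul_le_of_le_one_right (abs_nonneg _) hx01.2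
      exact mul_le_mul h4 h5 (mul_nonneg (abs_nonneg _) hx01.1) (by norm_num)
    · rw [hχ0 h1, mul_zero, mul_zero, abs_zero]; positivity
  rw [key]
  calc _ ≤ |a| * |d| * ‖y‖ + |b| * |(r - 1) * d| * |l| * 1 +
        |b| * |r⁻¹ * ((r - 1) * x)| * |l'| * ‖γ θ‖ := by
        refine (norm_add₃_le).trans (le_of_eq ?_)
        simp only [norm_smul, norm_neg, Real.norm_eq_abs, abs_mul, hγ.norm_deriv]
    _ ≤ (L * ‖w‖) * (M * g) * Λ₂ + (L * (R * ‖w‖)) * (M * g) * Λ₁ * 1 +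
        (L * (R * ‖w‖)) * (2 * g) * Λ * R := by
        gcongr
    _ = _ := by ring

/-- An entropy with bounded coefficient `lam`, bounded values on the curve, and `|lam'| ≤ Λ` extends
to a `C¹` map `F` of the plane whose differential is a multiple of the identity up to an error
which vanishes on the unit circle. In polar coordinates
`F (r γ(θ)) = χ(r) Φ(γ(θ)) + (r - 1) χ(r) lam(θ) γ(θ)`: near `r = 1` one finds
`∂_r F = lam γ` and `∂_θ F = r lam γ' + (r - 1) lam' γ`, where `r γ'` is the derivative
of `r γ(θ)` in `θ`. -/
lemma exists_extension_of_bounded {L R M Λ Λ₁ Λ₂ : ℝ} (hN : IsStrictlyConvexC1Norm N)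
    (hL0 : 0 < L) (hL : ∀ z, N z ≤ L * ‖z‖) (hR0 : 0 < R) (hR : ∀ z, ‖z‖ ≤ R * N z)
    {χ : ℝ → ℝ} (hM0 : 0 < M) (hχ : ContDiff ℝ 1 χ) (hχ1 : χ 1 = 1)
    (hχ01 : ∀ r, 0 ≤ χ r ∧ χ r ≤ 1) (hχ0 : ∀ r, 1 / 2 ≤ |r - 1| → χ r = 0)
    (hχ'0 : ∀ r, 1 / 2 < |r - 1| → deriv χ r = 0)
    (hχ' : ∀ r, |deriv χ r| ≤ M * min |r - 1| 1)
    (hγ : IsArcLengthParam N γ) (h : IsEntropyWith γ Φ lam)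
    (hΛ : ∀ θ, |deriv lam θ| ≤ Λ) (hΛ₁ : ∀ θ, |lam θ| ≤ Λ₁) (hΛ₂ : ∀ θ, ‖Φ (γ θ)‖ ≤ Λ₂) :
    ∃ (F : Plane → Plane) (α : Plane → ℝ), ContDiff ℝ 1 F ∧ HasCompactSupport F ∧
      (∀ z, N z = 1 → F z = Φ z) ∧
      ∀ z w, ‖fderiv ℝ F z w - α z • w‖ ≤
        L * (M * Λ₂ + R * M * Λ₁ + 2 * R ^ 2 * Λ) * min |N z - 1| 1 * ‖w‖ := by
  classical
  -- the coefficient as a function on the unit circle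
  let lamc : Plane → ℝ := Function.extend γ lam 0
  have hlamc : ∀ θ, lamc (γ θ) = lam θ := fun θ =>
    (hγ.factorsThrough h.periodic_coeff).extend_apply 0 θ
  let F : Plane → Plane := fun z => χ (N z) • Φ ((N z)⁻¹ • z) +
    ((N z - 1) * χ (N z) * lamc ((N z)⁻¹ • z)) • ((N z)⁻¹ • z)
  let H : ℝ × ℝ → Plane := fun q => χ q.1 • Φ (γ q.2) + ((q.1 - 1) * χ q.1 * lam q.2) • γ q.2
  have hFH : ∀ r θ, 0 < r → F (r • γ θ) = H (r, θ) := by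
    intro r θ hr
    simp only [F, H, hγ.map_smul_eq hr.le, inv_smul_smul₀ hr.ne', hlamc]
  have hH : ContDiff ℝ 1 H :=
    ((hχ.comp contDiff_fst).smul (h.contDiff_comp.comp contDiff_snd)).add
      ((((contDiff_fst.sub contDiff_const).mul (hχ.comp contDiff_fst)).mul
        (h.contDiff_coeff.comp contDiff_snd)).smul (hγ.contDiff.comp contDiff_snd))
  have hFzero : ∀ z, 1 / 2 ≤ |N z - 1| → F z = 0 := by
    intro z hz
    simp only [F, hχ0 _ hz, zero_smul, mul_zero, zero_mul, add_zero]
  have hF0 : F =ᶠ[𝓝 0] fun _ => 0 := by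
    have : ∀ᶠ z in 𝓝 (0 : Plane), N z < 1 / 2 :=
      (continuous_seminorm_plane N).continuousAt.eventually (gt_mem_nhds (by simp))
    filter_upwards [this] with z hz
    exact hFzero z (by rw [abs_of_neg (by linarith)]; linarith)
  have hFc : ContDiff ℝ 1 F := by
    rw [contDiff_iff_contDiffAt]
    intro z
    rcases eq_or_ne z 0 with rfl | hz
    · exact contDiffAt_const.congr_of_eventuallyEq hF0
    · have hz' : N z ≠ 0 := fun h0 => hz (hN.eq_zero_of_map_eq_zero z h0)
      obtain ⟨θ, hθ⟩ := hγ.exists_polar hz'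
      rw [hθ]
      exact hγ.contDiffAt_of_polar hFH hH (lt_of_le_of_ne (apply_nonneg N z) hz'.symm)
  have hΛ0 : 0 ≤ Λ := (abs_nonneg _).trans (hΛ 0)
  have hΛ₁0 : 0 ≤ Λ₁ := (abs_nonneg _).trans (hΛ₁ 0)
  have hΛ₂0 : 0 ≤ Λ₂ := (norm_nonneg _).trans (hΛ₂ 0)
  refine ⟨F, fun z => (χ (N z) + (N z - 1) * deriv χ (N z)) * lamc ((N z)⁻¹ • z), hFc, ?_, ?_, ?_⟩
  · refine HasCompactSupport.intro (isCompact_closedBall (0 : Plane) (R * (3 / 2))) fun z hz => ?_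
    rw [mem_closedBall_zero_iff, not_le] at hz
    have : 3 / 2 < N z := lt_of_mul_lt_mul_left (hz.trans_le (hR z)) hR0.le
    exact hFzero z (by rw [abs_of_pos (by linarith)]; linarith)
  · intro z hz
    simp [F, hz, hχ1]
  · intro z w
    rcases eq_or_ne z 0 with rfl | hz
    · have e1 : fderiv ℝ F 0 = 0 := by rw [hF0.fderiv_eq]; simp
      have e2 : χ (N 0) = 0 :=
        hχ0 _ (by rw [map_zero, zero_sub, abs_neg, abs_one]; norm_num)
      have e3 : deriv χ (N 0) = 0 := hχ'0 _ (by rw [map_zero, zero_sub, abs_neg, abs_one]; norm_num)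
      simp only [e1, e2, e3, zero_apply, mul_zero, add_zero, zero_mul,
        zero_smul, sub_zero, norm_zero]
      positivity
    have hz' : N z ≠ 0 := fun h0 => hz (hN.eq_zero_of_map_eq_zero z h0)
    obtain ⟨θ, hθ⟩ := hγ.exists_polar hz'
    set r := N z with hr
    have hr0 : 0 < r := lt_of_le_of_ne (apply_nonneg N z) hz'.symm
    have hd : HasFDerivAt F (fderiv ℝ F z) z := (hFc.differentiable one_ne_zero z).hasFDerivAt
    set D := fderiv ℝ F z with hD
    have hDr : D (γ θ) = deriv χ r • Φ (γ θ) + ((χ r + (r - 1) * deriv χ r) * lam θ) • γ θ := by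
      have h1 : HasDerivAt (fun s : ℝ => s • γ θ) (γ θ) r := by
        simpa using (hasDerivAt_id r).smul_const (γ θ)
      have h2 : HasDerivAt (fun s : ℝ => F (s • γ θ)) (D (γ θ)) r :=
        HasFDerivAt.comp_hasDerivAt (l := F) r (by rw [← hθ]; exact hd) h1
      have hχr : HasDerivAt χ (deriv χ r) r := (hχ.differentiable one_ne_zero r).hasDerivAt
      have h3 := (hχr.smul_const (Φ (γ θ))).add
        (((((hasDerivAt_id r).sub_const 1).mul hχr).mul_const (lam θ)).smul_const (γ θ))
      have h4 : (fun s : ℝ => F (s • γ θ)) =ᶠ[𝓝 r] fun s => χ s • Φ (γ θ) +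
          ((s - 1) * χ s * lam θ) • γ θ := by
        filter_upwards [lt_mem_nhds hr0] with s hs using hFH s θ hs
      have h5 := (h2.congr_of_eventuallyEq h4.symm).unique h3
      rw [h5]
      simp
    have hDθ : r • D (deriv γ θ) = (χ r * lam θ) • deriv γ θ +
        ((r - 1) * χ r) • (deriv lam θ • γ θ + lam θ • deriv γ θ) := by
      have h1 : HasDerivAt (fun t : ℝ => r • γ t) (r • deriv γ θ) θ :=
        (hγ.hasDerivAt θ).const_smul r
      have h2 : HasDerivAt (fun t : ℝ => F (r • γ t)) (D (r • deriv γ θ)) θ :=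
        HasFDerivAt.comp_hasDerivAt (l := F) θ (by rw [← hθ]; exact hd) h1
      have hl : HasDerivAt lam (deriv lam θ) θ :=
        (h.contDiff_coeff.differentiable one_ne_zero θ).hasDerivAt
      have h3 := ((h.hasDerivAt θ).const_smul (χ r)).add
        ((hl.const_mul ((r - 1) * χ r)).smul (hγ.hasDerivAt θ))
      have h4 : (fun t : ℝ => F (r • γ t)) = fun t => χ r • Φ (γ t) +
          ((r - 1) * χ r * lam t) • γ t := funext fun t => hFH r t hr0
      rw [h4] at h2
      have h5 := h2.unique h3
      rw [map_smul] at h5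
      rw [h5]
      module
    have hlz : lamc (r⁻¹ • z) = lam θ := by
      rw [hθ, inv_smul_smul₀ hr0.ne', hlamc]
    show ‖D w - ((χ r + (r - 1) * deriv χ r) * lamc (r⁻¹ • z)) • w‖ ≤ _
    rw [hlz]
    exact norm_polar_sub_smul_le hN hL0 hL hR0 hR hM0 hγ hr0 (hχ01 r) (hχ0 r) (hχ'0 r) (hχ' r)
      (hΛ θ) (hΛ₁ θ) (hΛ₂ θ) D hDr hDθ w

/-- An entropy extends, up to an affine map `z ↦ c z + p`, to a `C¹` map `F` of the plane whose
differential is a multiple of the identity up to an error controlled by `|N - 1|` and `‖lam'‖_∞`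
only: subtracting an affine map makes `lam` and `Φ` vanish at one point of the curve, hence they
are bounded in terms of `‖lam'‖_∞`. -/
theorem exists_extension (hN : IsStrictlyConvexC1Norm N) :
    ∃ K : ℝ, 0 < K ∧ ∀ (γ : ℝ → Plane), IsArcLengthParam N γ →
      ∀ (Φ : Plane → Plane) (lam : ℝ → ℝ) (Λ : ℝ), IsEntropyWith γ Φ lam →
      (∀ θ, |deriv lam θ| ≤ Λ) →
      ∃ (F : Plane → Plane) (α : Plane → ℝ) (c : ℝ) (p : Plane),
        ContDiff ℝ 1 F ∧ HasCompactSupport F ∧ (∀ z, N z = 1 → F z = Φ z - c • z - p) ∧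
        ∀ z w, ‖fderiv ℝ F z w - α z • w‖ ≤ K * Λ * min |N z - 1| 1 * ‖w‖ := by
  obtain ⟨L, hL0, hL⟩ := exists_seminorm_le_mul_norm N
  obtain ⟨R, hR0, hR⟩ := hN.exists_norm_le_mul
  obtain ⟨χ, M, hM0, hχ, hχ1, hχ01, hχ0, hχ'0, hχ'⟩ := exists_cutoff
  refine ⟨L * (M * (2 * Real.pi * (2 * Real.pi)) + R * M * (2 * Real.pi) + 2 * R ^ 2),
    by positivity, fun γ hγ Φ lam Λ h hΛ => ?_⟩
  set c := lam 0
  set p := Φ (γ 0) - c • γ 0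
  have h' := h.sub_affine hγ c p
  have hΛ₁ : ∀ θ, |lam θ - c| ≤ 2 * Real.pi * Λ := fun θ =>
    norm_sub_zero_le_of_periodic
      (h.contDiff_coeff.differentiable one_ne_zero) h.periodic_coeff hΛ θ
  have hΛ₂ : ∀ θ, ‖Φ (γ θ) - c • γ θ - p‖ ≤ 2 * Real.pi * (2 * Real.pi * Λ) := by
    intro θ
    have := norm_sub_zero_le_of_periodic
      (f := fun θ => Φ (γ θ) - c • γ θ - p)
      (fun t => (h'.hasDerivAt t).differentiableAt)
      (fun t => by simp only [hγ.periodic t]) (Λ := 2 * Real.pi * Λ)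
      (fun t => by
        rw [(h'.hasDerivAt t).deriv, norm_smul, hγ.norm_deriv, mul_one]
        exact hΛ₁ t) θ
    simpa [p] using this
  obtain ⟨F, α, h1, h2, h3, h4⟩ := h'.exists_extension_of_bounded hN hL0 hL hR0 hR hM0 hχ hχ1 hχ01
    hχ0 hχ'0 hχ' hγ (Λ := Λ) (fun θ => by rw [deriv_sub_const]; exact hΛ θ) hΛ₁ hΛ₂
  refine ⟨F, α, c, p, h1, h2, h3, fun z w => (h4 z w).trans (le_of_eq ?_)⟩
  ring

end IsEntropyWith

/-! ### Mollification -/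

open scoped Convolution in
/-- The convolution `ρ ⋆ f` of `f` with the normalized bump function `ρ` associated with `φ`. -/
noncomputable def mollify (φ : ContDiffBump (0 : Plane)) (f : Plane → Plane) : Plane → Plane :=
  φ.normed volume ⋆[ContinuousLinearMap.lsmul ℝ ℝ, volume] f

section Mollify

variable {φ : ContDiffBump (0 : Plane)} {f g : Plane → Plane}

lemma mollify_apply (φ : ContDiffBump (0 : Plane)) (f : Plane → Plane) (x : Plane) :
    mollify φ f x = ∫ y, φ.normed volume (x - y) • f y := by
  simp only [mollify, MeasureTheory.convolution_eq_swap, ContinuousLinearMap.lsmul_apply]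

lemma integrable_mollify_integrand (hf : LocallyIntegrable f) (x : Plane) :
    Integrable (fun y => φ.normed volume (x - y) • f y) :=
  (φ.hasCompactSupport_normed.convolutionExists_left (ContinuousLinearMap.lsmul ℝ ℝ)
    φ.continuous_normed hf x).integrable_swap

lemma mollify_sub (hf : LocallyIntegrable f) (hg : LocallyIntegrable g) (x : Plane) :
    mollify φ (f - g) x = mollify φ f x - mollify φ g x := by
  simp only [mollify_apply, Pi.sub_apply, smul_sub]
  exact integral_sub (integrable_mollify_integrand hf x) (integrable_mollify_integrand hg x)

lemma contDiff_mollify (hf : LocallyIntegrable f) : ContDiff ℝ 1 (mollify φ f) :=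
  φ.hasCompactSupport_normed.contDiff_convolution_left _ (φ.contDiff_normed (n := 1)) hf

lemma integrable_mollify (hf : Integrable f) : Integrable (mollify φ f) :=
  φ.integrable_normed.integrable_convolution _ hf

lemma integral_norm_mollify_le (hf : Integrable f) :
    ∫ x, ‖mollify φ f x‖ ≤ ∫ x, ‖f x‖ := by
  have h1 := integral_convolution (ContinuousLinearMap.lsmul ℝ ℝ)
    (φ.integrable_normed (μ := volume)) hf.norm
  rw [φ.integral_normed, ContinuousLinearMap.lsmul_apply, one_smul] at h1
  rw [← h1]
  refine integral_mono (integrable_mollify hf).norm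
    ((φ.integrable_normed (μ := volume)).integrable_convolution _ hf.norm) fun x => ?_
  refine (norm_integral_le_integral_norm _).trans (le_of_eq ?_)
  refine integral_congr_ae (Eventually.of_forall fun t => ?_)
  simp [norm_smul, abs_of_nonneg (φ.nonneg_normed t)]

lemma integral_norm_mollify_sub_le_of_uniform {η : ℝ} (hg : Continuous g)
    (hgc : HasCompactSupport g) (hφ1 : φ.rOut ≤ 1)
    (hφ : ∀ x y, dist x y < φ.rOut → dist (g x) (g y) ≤ η) :
    ∫ x, ‖mollify φ g x - g x‖ ≤
      η * volume.real (Metric.cthickening 1 (tsupport g)) := by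
  have hK : IsCompact (Metric.cthickening 1 (tsupport g)) := hgc.isCompact.cthickening
  have hle : ∀ x, ‖mollify φ g x - g x‖ ≤
      (Metric.cthickening 1 (tsupport g)).indicator (fun _ => η) x := by
    intro x
    by_cases hx : x ∈ Metric.cthickening 1 (tsupport g)
    · rw [Set.indicator_of_mem hx, ← dist_eq_norm]
      exact φ.dist_normed_convolution_le hg.aestronglyMeasurable fun y hy => hφ y x hy
    · rw [Set.indicator_of_notMem hx]
      have h0 : ∀ y ∈ Metric.ball x 1, g y = 0 := by
        intro y hy
        by_contra hne
        exact hx (Metric.mem_cthickening_of_dist_le x y 1 _ (subset_tsupport g hne)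
          (by rw [dist_comm]; exact (Metric.mem_ball.1 hy).le))
      have : mollify φ g x = g x := φ.normed_convolution_eq_right fun y hy => by
        rw [h0 y (Metric.ball_subset_ball hφ1 hy), h0 x (Metric.mem_ball_self one_pos)]
      rw [this, sub_self, norm_zero]
  calc ∫ x, ‖mollify φ g x - g x‖
      ≤ ∫ x, (Metric.cthickening 1 (tsupport g)).indicator (fun _ => η) x :=
        integral_mono_of_nonneg (Eventually.of_forall fun _ => norm_nonneg _)
          ((integrable_indicator_iff hK.measurableSet).2
            (integrableOn_const hK.measure_lt_top.ne)) (Eventually.of_forall hle)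
    _ = _ := by
        rw [integral_indicator hK.measurableSet, setIntegral_const, smul_eq_mul, mul_comm]

/-- Mollifications of an integrable function converge to it in `L¹`. -/
theorem tendsto_integral_norm_mollify_sub {φ : ℕ → ContDiffBump (0 : Plane)}
    (hφ : Tendsto (fun i => (φ i).rOut) atTop (𝓝 0)) (hf : Integrable f) :
    Tendsto (fun i => ∫ x, ‖mollify (φ i) f x - f x‖) atTop (𝓝 0) := by
  rw [Metric.tendsto_atTop']
  intro ε hε
  obtain ⟨g, hgc, hfg, hg, hgi⟩ := hf.exists_hasCompactSupport_integral_sub_le (half_pos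
    (half_pos hε))
  set V := volume.real (Metric.cthickening 1 (tsupport g))
  have hV : 0 ≤ V := measureReal_nonneg
  have hη : 0 < ε / 4 / (V + 1) := by positivity
  obtain ⟨δ, hδ, hδg⟩ := Metric.uniformContinuous_iff.1
    (hg.uniformContinuous_of_tendsto_cocompact hgc.is_zero_at_infty) _ hη
  have hev : ∀ᶠ i in atTop, (φ i).rOut < min δ 1 := hφ.eventually (gt_mem_nhds (by positivity))
  obtain ⟨i₀, hi₀⟩ := eventually_atTop.1 hev
  refine ⟨i₀, fun i hi => ?_⟩
  have hi' := hi₀ i hi.le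
  have h1 := integral_norm_mollify_sub_le_of_uniform hg hgc
    (hi'.le.trans (min_le_right _ _)) fun x y hxy =>
      (hδg (hxy.trans (hi'.trans_le (min_le_left _ _)))).le
  have h2 := integral_norm_mollify_le (φ := φ i) (hf.sub hgi)
  have h3 : ∫ x, ‖mollify (φ i) f x - f x‖ ≤ (∫ x, ‖mollify (φ i) (f - g) x‖) +
      (∫ x, ‖mollify (φ i) g x - g x‖) + ∫ x, ‖f x - g x‖ := by
    have i1 := (integrable_mollify (φ := φ i) (hf.sub hgi)).norm
    have i2 : Integrable fun x => ‖mollify (φ i) g x - g x‖ :=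
      ((integrable_mollify hgi).sub hgi).norm
    have i3 : Integrable fun x => ‖f x - g x‖ := (hf.sub hgi).norm
    have i12 : Integrable fun x => ‖mollify (φ i) (f - g) x‖ + ‖mollify (φ i) g x - g x‖ :=
      i1.add i2
    rw [← integral_add i1 i2, ← integral_add i12 i3]
    refine integral_mono_of_nonneg (Eventually.of_forall fun _ => norm_nonneg _)
      (i12.add i3) (Eventually.of_forall fun x => ?_)
    have : mollify (φ i) f x - f x = mollify (φ i) (f - g) x + (mollify (φ i) g x - g x) -
        (f x - g x) := by
      rw [mollify_sub hf.locallyIntegrable hgi.locallyIntegrable]; abel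
    show ‖mollify (φ i) f x - f x‖ ≤ _
    rw [this]
    exact (norm_sub_le _ _).trans (add_le_add_left (norm_add_le _ _) _)
  have h4 : ε / 4 / (V + 1) * V ≤ ε / 4 := by
    rw [div_mul_eq_mul_div, div_le_iff₀ (by positivity)]
    nlinarith
  rw [Real.dist_0_eq_abs, abs_of_nonneg (integral_nonneg fun _ => norm_nonneg _)]
  have h5 : ∫ x, ‖(f - g) x‖ = ∫ x, ‖f x - g x‖ := rfl
  linarith

open ContinuousLinearMap in
lemma fderiv_mollify_apply (hf : LocallyIntegrable f) (x e : Plane) :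
    fderiv ℝ (mollify φ f) x e = ∫ y, fderiv ℝ (φ.normed volume) (x - y) e • f y := by
  have h1 := (φ.hasCompactSupport_normed.hasFDerivAt_convolution_left (lsmul ℝ ℝ)
    (φ.contDiff_normed (μ := volume) (n := 1)) hf x).fderiv
  have h2 := ((φ.hasCompactSupport_normed (μ := volume)).fderiv ℝ).convolutionExists_left
    ((lsmul ℝ ℝ : ℝ →L[ℝ] Plane →L[ℝ] Plane).precompL Plane)
    ((φ.contDiff_normed (μ := volume) (n := 1)).continuous_fderiv one_ne_zero) hf x
  rw [mollify, h1, MeasureTheory.convolution_eq_swap, ContinuousLinearMap.integral_apply]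
  · simp [precompL_apply]
  · exact h2.integrable_swap

/-- The test function `y ↦ ρ(x - y)`. -/
noncomputable def bumpTest (φ : ContDiffBump (0 : Plane)) {Ω : Opens Plane} {x : Plane}
    (h : Metric.closedBall x φ.rOut ⊆ Ω) : 𝓓(Ω, ℝ) where
  toFun y := φ.normed volume (x - y)
  contDiff' := φ.contDiff_normed.comp (contDiff_const.sub contDiff_id)
  hasCompactSupport' := by
    refine HasCompactSupport.intro (isCompact_closedBall x φ.rOut) fun y hy => ?_
    have : x - y ∉ Function.support (φ.normed (volume : Measure Plane)) := by
      rw [φ.support_normed_eq]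
      intro h'
      exact hy (by simpa [dist_eq_norm, norm_sub_rev] using (Metric.mem_ball.1 h').le)
    simpa using this
  tsupport_subset' := by
    refine subset_trans ?_ h
    refine closure_minimal (fun y hy => ?_) Metric.isClosed_closedBall
    have : x - y ∈ Function.support (φ.normed (volume : Measure Plane)) := hy
    rw [φ.support_normed_eq] at this
    simpa [dist_eq_norm, norm_sub_rev] using (Metric.mem_ball.1 this).le

lemma fderiv_bumpTest {Ω : Opens Plane} {x : Plane}
    (h : Metric.closedBall x φ.rOut ⊆ Ω) (y : Plane) :
    fderiv ℝ (bumpTest φ h) y = -fderiv ℝ (φ.normed volume) (x - y) := by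
  have h1 : HasFDerivAt (fun y => x - y) (-ContinuousLinearMap.id ℝ Plane) y :=
    (hasFDerivAt_id y).const_sub x
  have h2 := ((φ.contDiff_normed (μ := volume) (n := 1)).differentiable one_ne_zero
    (x - y)).hasFDerivAt.comp y h1
  have h3 : (bumpTest φ h : Plane → ℝ) = φ.normed volume ∘ fun y => x - y := rfl
  rw [h3, h2.fderiv]
  ext; simp

/-- Away from the boundary of `Ω`, mollification commutes with weak derivatives. -/
lemma fderiv_mollify_eq_mollify {Ω : Opens Plane} {v : Plane → Plane} {G : Fin 2 → Plane → Plane}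
    (hv : LocallyIntegrable ((Ω : Set Plane).indicator v)) (hG : HasWeakGradient Ω v G) {x : Plane}
    (h : Metric.closedBall x φ.rOut ⊆ Ω) (j : Fin 2) :
    fderiv ℝ (mollify φ ((Ω : Set Plane).indicator v)) x (EuclideanSpace.single j 1) =
      mollify φ ((Ω : Set Plane).indicator (G j)) x := by
  have h1 := hG j (bumpTest φ h)
  have hΩ := Ω.isOpen.measurableSet
  rw [fderiv_mollify_apply hv, mollify_apply]
  have e1 : (fun y => fderiv ℝ (φ.normed volume) (x - y) (EuclideanSpace.single j 1) •
      (Ω : Set Plane).indicator v y) = (Ω : Set Plane).indicator (fun y =>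
        fderiv ℝ (φ.normed volume) (x - y) (EuclideanSpace.single j 1) • v y) := by
    ext1 y
    by_cases hy : y ∈ (Ω : Set Plane) <;> simp [hy]
  have e2 : (fun y => φ.normed volume (x - y) • (Ω : Set Plane).indicator (G j) y) =
      (Ω : Set Plane).indicator (fun y => φ.normed volume (x - y) • G j y) := by
    ext1 y
    by_cases hy : y ∈ (Ω : Set Plane) <;> simp [hy]
  rw [e1, e2, integral_indicator hΩ, integral_indicator hΩ]
  simp only [fderiv_bumpTest, neg_apply, neg_smul, integral_neg] at h1
  exact neg_injective h1

/-- Away from the boundary of `Ω`, mollifications of divergence free maps are divergence free. -/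
lemma div_mollify_eq_zero {Ω : Opens Plane} {v : Plane → Plane}
    (hv : LocallyIntegrable ((Ω : Set Plane).indicator v)) (hdiv : DivFree Ω v) {x : Plane}
    (h : Metric.closedBall x φ.rOut ⊆ Ω) :
    ∑ j : Fin 2, fderiv ℝ (mollify φ ((Ω : Set Plane).indicator v)) x
      (EuclideanSpace.single j 1) j = 0 := by
  have h1 := hdiv (bumpTest φ h)
  have hΩ := Ω.isOpen.measurableSet
  have hint : ∀ j : Fin 2, Integrable (fun y => fderiv ℝ (φ.normed volume) (x - y)
      (EuclideanSpace.single j 1) • (Ω : Set Plane).indicator v y) := by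
    intro j
    have hc : Continuous fun y => fderiv ℝ (φ.normed (volume : Measure Plane)) y
        (EuclideanSpace.single j 1) :=
      ((φ.contDiff_normed (μ := volume) (n := 1)).continuous_fderiv one_ne_zero).clm_apply
        continuous_const
    have hs : HasCompactSupport fun y => fderiv ℝ (φ.normed (volume : Measure Plane)) y
        (EuclideanSpace.single j 1) :=
      (φ.hasCompactSupport_normed (μ := volume)).fderiv_apply ℝ _
    exact (hs.convolutionExists_left (ContinuousLinearMap.lsmul ℝ ℝ) hc hv x).integrable_swap
  have e1 : ∀ j : Fin 2, fderiv ℝ (mollify φ ((Ω : Set Plane).indicator v)) x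
      (EuclideanSpace.single j 1) j = ∫ y, fderiv ℝ (φ.normed volume) (x - y)
      (EuclideanSpace.single j 1) * (Ω : Set Plane).indicator v y j := by
    intro j
    rw [fderiv_mollify_apply hv]
    have := (EuclideanSpace.proj (𝕜 := ℝ) j).integral_comp_comm (hint j)
    simpa using this.symm
  have hint' : ∀ j : Fin 2, Integrable (fun y => fderiv ℝ (φ.normed volume) (x - y)
      (EuclideanSpace.single j 1) * (Ω : Set Plane).indicator v y j) := by
    intro j
    simpa using (EuclideanSpace.proj (𝕜 := ℝ) j).integrable_comp (hint j)
  simp only [e1]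
  rw [← integral_finsetSum _ fun j _ => hint' j]
  have e2 : (fun y => ∑ j : Fin 2, fderiv ℝ (φ.normed volume) (x - y)
      (EuclideanSpace.single j 1) * (Ω : Set Plane).indicator v y j) =
      (Ω : Set Plane).indicator (fun y => fderiv ℝ (φ.normed volume) (x - y) (v y)) := by
    ext1 y
    by_cases hy : y ∈ (Ω : Set Plane)
    · have hz : v y = ∑ j : Fin 2, v y j • EuclideanSpace.single j (1 : ℝ) := by
        ext i; fin_cases i <;> simp
      simp only [Set.indicator_of_mem hy]
      conv_rhs => rw [hz]
      simp [mul_comm]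
    · simp [hy]
  rw [e2, integral_indicator hΩ]
  simp only [fderiv_bumpTest, neg_apply, integral_neg] at h1
  exact neg_eq_zero.1 h1

end Mollify

/-! ### Entropy productions of divergence free Sobolev maps -/

section EntropyProduction

lemma eq_sum_single (w : Plane) : w = ∑ j : Fin 2, w j • EuclideanSpace.single j (1 : ℝ) := by
  ext i; fin_cases i <;> simp

lemma integral_fderiv_apply_eq_neg {φ : Plane → ℝ} {W : Plane → Plane} (hφ : ContDiff ℝ 1 φ)
    (hφc : HasCompactSupport φ) (hW : ContDiff ℝ 1 W) :
    ∫ x, fderiv ℝ φ x (W x) =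
      -∫ x, φ x * ∑ j : Fin 2, fderiv ℝ W x (EuclideanSpace.single j 1) j := by
  have hφ' : Continuous (fderiv ℝ φ) := hφ.continuous_fderiv one_ne_zero
  have hW' : Continuous (fderiv ℝ W) := hW.continuous_fderiv one_ne_zero
  have hcoord : ∀ (x : Plane) (j : Fin 2), HasFDerivAt (fun y => W y j)
      ((EuclideanSpace.proj (𝕜 := ℝ) j).comp (fderiv ℝ W x)) x := fun x j =>
    (EuclideanSpace.proj (𝕜 := ℝ) j).hasFDerivAt.comp x
      (hW.differentiable one_ne_zero x).hasFDerivAt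
  have hWj : ∀ j : Fin 2, Continuous fun x => W x j := fun j =>
    (EuclideanSpace.proj (𝕜 := ℝ) j).continuous.comp hW.continuous
  have hW'j : ∀ j : Fin 2, Continuous fun x => fderiv ℝ W x (EuclideanSpace.single j 1) j :=
    fun j => (EuclideanSpace.proj (𝕜 := ℝ) j).continuous.comp (hW'.clm_apply continuous_const)
  have hi1 : ∀ j : Fin 2, Integrable fun x => fderiv ℝ φ x (EuclideanSpace.single j 1) * W x j :=
    fun j => ((hφ'.clm_apply continuous_const).mul (hWj j)).integrable_of_hasCompactSupport
      ((hφc.fderiv_apply ℝ _).mul_right)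
  have hi2 : ∀ j : Fin 2, Integrable fun x =>
      φ x * fderiv ℝ W x (EuclideanSpace.single j 1) j :=
    fun j => (hφ.continuous.mul (hW'j j)).integrable_of_hasCompactSupport hφc.mul_right
  have hibp : ∀ j : Fin 2, ∫ x, φ x * fderiv ℝ W x (EuclideanSpace.single j 1) j =
      -∫ x, fderiv ℝ φ x (EuclideanSpace.single j 1) * W x j := by
    intro j
    have he : ∀ x, fderiv ℝ (fun y => W y j) x (EuclideanSpace.single j 1) =
        fderiv ℝ W x (EuclideanSpace.single j 1) j := fun x => by
      rw [(hcoord x j).fderiv]; simp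
    have := integral_mul_fderiv_eq_neg_fderiv_mul_of_integrable (μ := (volume : Measure Plane))
      (f := φ) (g := fun y => W y j) (v := EuclideanSpace.single j 1) (hi1 j)
      (by simpa only [he] using hi2 j)
      ((hφ.continuous.mul (hWj j)).integrable_of_hasCompactSupport hφc.mul_right)
      (fun x _ => hφ.differentiable one_ne_zero x)
      (fun x _ => (hcoord x j).differentiableAt)
    simpa only [he] using this
  have h1 : ∀ x, fderiv ℝ φ x (W x) =
      ∑ j : Fin 2, fderiv ℝ φ x (EuclideanSpace.single j 1) * W x j := by
    intro x
    conv_lhs => rw [eq_sum_single (W x)]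
    simp [mul_comm]
  simp only [h1, Finset.mul_sum]
  rw [integral_finsetSum _ fun j _ => hi1 j, integral_finsetSum _ fun j _ => hi2 j,
    ← Finset.sum_neg_distrib]
  exact Finset.sum_congr rfl fun j _ => by rw [hibp j, neg_neg]

variable {N : Seminorm ℝ Plane} {F : Plane → Plane} {α : Plane → ℝ} {K : ℝ}

/-- The bound on the entropy production of a smooth divergence free map `u`. The part `α Id` of
the differential of the entropy does not contribute, as `u` is divergence free. -/
lemma abs_integral_fderiv_comp_le_of_contDiff {φ : Plane → ℝ} {u : Plane → Plane}
    (hφ : ContDiff ℝ 1 φ) (hφc : HasCompactSupport φ) (hu : ContDiff ℝ 1 u)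
    (hdiv : ∀ x ∈ tsupport φ, ∑ j : Fin 2, fderiv ℝ u x (EuclideanSpace.single j 1) j = 0)
    (hF : ContDiff ℝ 1 F)
    (hα : ∀ z w, ‖fderiv ℝ F z w - α z • w‖ ≤ K * min |N z - 1| 1 * ‖w‖) :
    |∫ x, fderiv ℝ φ x (F (u x))| ≤
      K * ∫ x, |φ x| * min |N (u x) - 1| 1 *
        ∑ j : Fin 2, ‖fderiv ℝ u x (EuclideanSpace.single j 1)‖ := by
  have hibp : ∫ x, fderiv ℝ φ x (F (u x)) =
      -∫ x, φ x * ∑ j : Fin 2, fderiv ℝ (F ∘ u) x (EuclideanSpace.single j 1) j :=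
    integral_fderiv_apply_eq_neg hφ hφc (hF.comp hu)
  rw [hibp, abs_neg, ← integral_const_mul]
  have hcont : Continuous fun x => K * (|φ x| * min |N (u x) - 1| 1 *
        ∑ j : Fin 2, ‖fderiv ℝ u x (EuclideanSpace.single j 1)‖) := by
    have h1 := hφ.continuous
    have h2 : Continuous fun x => N (u x) := (continuous_seminorm_plane N).comp hu.continuous
    have h3 : ∀ j : Fin 2, Continuous fun x => fderiv ℝ u x (EuclideanSpace.single j 1) :=
      fun j => (hu.continuous_fderiv one_ne_zero).clm_apply continuous_const
    exact continuous_const.mul ((h1.abs.mul ((h2.sub continuous_const).abs.min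
      continuous_const)).mul (continuous_finsetSum _ fun j _ => (h3 j).norm))
  refine abs_integral_le_integral_abs.trans (integral_mono_of_nonneg
    (Eventually.of_forall fun _ => abs_nonneg _)
    (hcont.integrable_of_hasCompactSupport ?_) (Eventually.of_forall fun x => ?_))
  · refine HasCompactSupport.intro hφc fun x hx => ?_
    rw [image_eq_zero_of_notMem_tsupport hx]
    simp
  · show |φ x * _| ≤ _
    by_cases hx : x ∈ tsupport φ
    swap
    · have h0 : φ x = 0 := image_eq_zero_of_notMem_tsupport hx
      simp only [h0, abs_zero, zero_mul, mul_zero, le_refl]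
    have hchain : fderiv ℝ (F ∘ u) x = (fderiv ℝ F (u x)).comp (fderiv ℝ u x) :=
      fderiv_comp x (hF.differentiable one_ne_zero _) (hu.differentiable one_ne_zero _)
    set D := fderiv ℝ F (u x)
    have h1 : ∑ j : Fin 2, fderiv ℝ (F ∘ u) x (EuclideanSpace.single j 1) j =
        ∑ j : Fin 2, (D (fderiv ℝ u x (EuclideanSpace.single j 1)) -
          α (u x) • fderiv ℝ u x (EuclideanSpace.single j 1)) j := by
      simp only [hchain, ContinuousLinearMap.comp_apply, PiLp.sub_apply, PiLp.smul_apply,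
        smul_eq_mul, Finset.sum_sub_distrib, ← Finset.mul_sum, hdiv x hx, mul_zero, sub_zero]
    rw [h1, abs_mul]
    calc |φ x| * |∑ j : Fin 2, (D (fderiv ℝ u x (EuclideanSpace.single j 1)) -
          α (u x) • fderiv ℝ u x (EuclideanSpace.single j 1)) j|
        ≤ |φ x| * ∑ j : Fin 2, K * min |N (u x) - 1| 1 *
          ‖fderiv ℝ u x (EuclideanSpace.single j 1)‖ := by
          gcongr
          refine (Finset.abs_sum_le_sum_abs _ _).trans (Finset.sum_le_sum fun j _ => ?_)
          exact (abs_coord_le_norm _ j).trans (hα _ _)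
      _ = _ := by rw [← Finset.mul_sum]; ring

lemma fderiv_eq_zero_of_notMem {Ω : Opens Plane} (φ : 𝓓(Ω, ℝ)) {x : Plane} (hx : x ∉ Ω) :
    fderiv ℝ φ x = 0 := by
  have : x ∉ tsupport (fderiv ℝ φ) := fun h =>
    hx (φ.tsupport_subset (tsupport_fderiv_subset ℝ h))
  exact image_eq_zero_of_notMem_tsupport this

lemma eq_zero_of_notMem {Ω : Opens Plane} (φ : 𝓓(Ω, ℝ)) {x : Plane} (hx : x ∉ Ω) :
    φ x = 0 :=
  image_eq_zero_of_notMem_tsupport fun h => hx (φ.tsupport_subset h)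

/-- Standard mollifiers at scale `1 / (i + 1)`. -/
noncomputable def stdBump (i : ℕ) : ContDiffBump (0 : Plane) where
  rIn := 1 / (2 * (i + 1))
  rOut := 1 / (i + 1)
  rIn_pos := by positivity
  rIn_lt_rOut := by
    rw [div_lt_div_iff₀ (by positivity) (by positivity)]
    have : (0 : ℝ) ≤ i := Nat.cast_nonneg i
    linarith

lemma tendsto_stdBump_rOut : Tendsto (fun i => (stdBump i).rOut) atTop (𝓝 0) :=
  tendsto_one_div_add_atTop_nhds_zero_nat

lemma ae_tendsto_mollify_stdBump {f : Plane → Plane} (hf : LocallyIntegrable f) :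
    ∀ᵐ x, Tendsto (fun i => mollify (stdBump i) f x) atTop (𝓝 (f x)) :=
  ContDiffBump.ae_convolution_tendsto_right_of_locallyIntegrable (K := 2) tendsto_stdBump_rOut
    (Eventually.of_forall fun i => le_of_eq (by simp only [stdBump]; field_simp)) hf

/-- The bound on the entropy production of a divergence free map `v ∈ W^{1,2}`, obtained from the
smooth case by mollification. -/
theorem abs_integral_fderiv_comp_le {Ω : Opens Plane} (hΩ : volume (Ω : Set Plane) ≠ ∞)
    {v : Plane → Plane} {G : Fin 2 → Plane → Plane} (hv : IsW12 Ω v G) (hdiv : DivFree Ω v)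
    (hF : ContDiff ℝ 1 F) (hFc : HasCompactSupport F) (hK : 0 ≤ K)
    (hα : ∀ z w, ‖fderiv ℝ F z w - α z • w‖ ≤ K * min |N z - 1| 1 * ‖w‖) (φ : 𝓓(Ω, ℝ)) :
    |∫ x in Ω, fderiv ℝ φ x (F (v x))| ≤
      K * ∫ x in Ω, |φ x| * min |N (v x) - 1| 1 * ∑ j : Fin 2, ‖G j x‖ := by
  have hΩm := Ω.isOpen.measurableSet
  have : IsFiniteMeasure (volume.restrict (Ω : Set Plane)) :=
    ⟨by rw [Measure.restrict_apply_univ]; exact hΩ.lt_top⟩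
  set w : Plane → Plane := (Ω : Set Plane).indicator v with hw
  set H : Fin 2 → Plane → Plane := fun j => (Ω : Set Plane).indicator (G j) with hH
  have hwi : Integrable w :=
    (integrable_indicator_iff hΩm).2 (hv.memLp.integrable (by norm_num))
  have hHi : ∀ j, Integrable (H j) := fun j =>
    (integrable_indicator_iff hΩm).2 ((hv.memLp_grad j).integrable (by norm_num))
  have hφ1 : ContDiff ℝ 1 φ := φ.contDiff.of_le (by exact_mod_cast le_top)
  have hφc := φ.hasCompactSupport
  obtain ⟨Cφ, hCφ⟩ := hφ1.continuous.bounded_above_of_compact_support hφc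
  have hCφ0 : 0 ≤ Cφ := (norm_nonneg _).trans (hCφ 0)
  obtain ⟨CF, hCF⟩ := hF.continuous.bounded_above_of_compact_support hFc
  have hφ' : Continuous (fderiv ℝ φ) := hφ1.continuous_fderiv one_ne_zero
  set u : ℕ → Plane → Plane := fun i => mollify (stdBump i) w with hu
  have hui : ∀ i, ContDiff ℝ 1 (u i) := fun i => contDiff_mollify hwi.locallyIntegrable
  have hae : ∀ᵐ x, Tendsto (fun i => u i x) atTop (𝓝 (w x)) :=
    ae_tendsto_mollify_stdBump hwi.locallyIntegrable
  have hg : Continuous fun z => min |N z - 1| 1 := by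
    have := continuous_seminorm_plane N
    fun_prop
  have hg1 : ∀ z, |min |N z - 1| 1| ≤ 1 := fun z => by
    rw [abs_of_nonneg (by positivity)]; exact min_le_right _ _
  -- the closed balls of radius `rOut` around the support of the test function lie in `Ω`
  obtain ⟨δ, hδ, hδΩ⟩ := hφc.isCompact.exists_cthickening_subset_open Ω.isOpen φ.tsupport_subset
  have hball : ∀ᶠ i in atTop, ∀ x ∈ tsupport φ,
      Metric.closedBall x (stdBump i).rOut ⊆ (Ω : Set Plane) := by
    filter_upwards [tendsto_stdBump_rOut.eventually (gt_mem_nhds hδ)] with i hi x hx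
    exact ((Metric.closedBall_subset_closedBall hi.le).trans
      (Metric.closedBall_subset_cthickening hx δ)).trans hδΩ
  -- convergence of the left-hand side
  have hlim1 : Tendsto (fun i => |∫ x, fderiv ℝ φ x (F (u i x))|) atTop
      (𝓝 |∫ x, fderiv ℝ φ x (F (w x))|) := by
    refine (tendsto_integral_of_dominated_convergence (fun x => ‖fderiv ℝ φ x‖ * CF)
      (fun i => ?_) ?_ (fun i => Eventually.of_forall fun x => ?_) ?_).abs
    · exact (hφ'.clm_apply (hF.continuous.comp (hui i).continuous)).aestronglyMeasurable
    · exact (hφ'.norm.integrable_of_hasCompactSupport (hφc.fderiv ℝ).norm).mul_const CF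
    · exact ((fderiv ℝ φ x).le_opNorm _).trans (by gcongr; exact hCF _)
    · filter_upwards [hae] with x hx
      exact ((fderiv ℝ φ x).continuous.comp hF.continuous).continuousAt.tendsto.comp hx
  -- convergence of the right-hand side
  have hSi : Integrable fun x => ∑ j : Fin 2, ‖H j x‖ :=
    integrable_finsetSum _ fun j _ => (hHi j).norm
  have hlim2 : Tendsto (fun i => ∫ x, |φ x| * min |N (u i x) - 1| 1 * ∑ j : Fin 2, ‖H j x‖) atTop
      (𝓝 (∫ x, |φ x| * min |N (w x) - 1| 1 * ∑ j : Fin 2, ‖H j x‖)) := by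
    refine tendsto_integral_of_dominated_convergence (fun x => Cφ * ∑ j : Fin 2, ‖H j x‖)
      (fun i => ?_) (hSi.const_mul Cφ) (fun i => Eventually.of_forall fun x => ?_) ?_
    · exact ((hφ1.continuous.abs.mul
        (hg.comp (hui i).continuous)).aestronglyMeasurable).mul hSi.aestronglyMeasurable
    · rw [norm_mul, norm_mul, Real.norm_of_nonneg (Finset.sum_nonneg fun j _ => norm_nonneg _),
        Real.norm_eq_abs, abs_abs, Real.norm_eq_abs]
      gcongr
      calc |φ x| * _ ≤ Cφ * 1 := mul_le_mul (hCφ x) (hg1 _) (abs_nonneg _) hCφ0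
        _ = Cφ := mul_one _
    · filter_upwards [hae] with x hx
      exact ((hg.continuousAt.tendsto.comp hx).const_mul _).mul_const _
  have hlim3 : Tendsto (fun i => ∑ j : Fin 2, ∫ x, ‖mollify (stdBump i) (H j) x - H j x‖) atTop
      (𝓝 0) := by
    simpa using tendsto_finsetSum Finset.univ fun j _ =>
      tendsto_integral_norm_mollify_sub tendsto_stdBump_rOut (hHi j)
  have hle : ∀ᶠ i in atTop, |∫ x, fderiv ℝ φ x (F (u i x))| ≤
      K * ((∫ x, |φ x| * min |N (u i x) - 1| 1 * ∑ j : Fin 2, ‖H j x‖) +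
        Cφ * ∑ j : Fin 2, ∫ x, ‖mollify (stdBump i) (H j) x - H j x‖) := by
    filter_upwards [hball] with i hi
    refine (abs_integral_fderiv_comp_le_of_contDiff hφ1 hφc (hui i)
      (fun x hx => div_mollify_eq_zero hwi.locallyIntegrable hdiv (hi x hx)) hF hα).trans ?_
    gcongr
    have hdi : ∀ j, Integrable fun x => ‖mollify (stdBump i) (H j) x - H j x‖ := fun j =>
      ((integrable_mollify (hHi j)).sub (hHi j)).norm
    have hI : Integrable fun x => |φ x| * min |N (u i x) - 1| 1 * ∑ j : Fin 2, ‖H j x‖ := by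
      refine (hSi.const_mul Cφ).mono' (((hφ1.continuous.abs.mul
        (hg.comp (hui i).continuous)).aestronglyMeasurable).mul hSi.aestronglyMeasurable)
        (Eventually.of_forall fun x => ?_)
      rw [norm_mul, norm_mul, Real.norm_of_nonneg (Finset.sum_nonneg fun j _ => norm_nonneg _),
        Real.norm_eq_abs, abs_abs, Real.norm_eq_abs]
      gcongr
      calc |φ x| * _ ≤ Cφ * 1 := mul_le_mul (hCφ x) (hg1 _) (abs_nonneg _) hCφ0
        _ = Cφ := mul_one _
    have hJ : Integrable fun x => Cφ * ∑ j : Fin 2, ‖mollify (stdBump i) (H j) x - H j x‖ :=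
      (integrable_finsetSum _ fun j _ => hdi j).const_mul Cφ
    rw [← integral_finsetSum _ fun j _ => hdi j, ← integral_const_mul, ← integral_add hI hJ]
    refine integral_mono_of_nonneg (Eventually.of_forall fun x => by positivity) (hI.add hJ)
      (Eventually.of_forall fun x => ?_)
    show |φ x| * min |N (u i x) - 1| 1 *
        ∑ j : Fin 2, ‖fderiv ℝ (u i) x (EuclideanSpace.single j 1)‖ ≤
      |φ x| * min |N (u i x) - 1| 1 * (∑ j : Fin 2, ‖H j x‖) +
        Cφ * ∑ j : Fin 2, ‖mollify (stdBump i) (H j) x - H j x‖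
    by_cases hx : x ∈ tsupport φ
    swap
    · rw [image_eq_zero_of_notMem_tsupport hx]
      simp only [abs_zero, zero_mul, zero_add]
      positivity
    have h1 : ∀ j, fderiv ℝ (u i) x (EuclideanSpace.single j 1) =
        mollify (stdBump i) (H j) x := fun j =>
      fderiv_mollify_eq_mollify hwi.locallyIntegrable hv.hasWeakGradient (hi x hx) j
    have h2 : ∑ j : Fin 2, ‖fderiv ℝ (u i) x (EuclideanSpace.single j 1)‖ ≤
        (∑ j : Fin 2, ‖H j x‖) + ∑ j : Fin 2, ‖mollify (stdBump i) (H j) x - H j x‖ := by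
      rw [← Finset.sum_add_distrib]
      refine Finset.sum_le_sum fun j _ => ?_
      rw [h1 j]
      exact norm_le_norm_add_norm_sub' _ _
    have h3 : |φ x| * min |N (u i x) - 1| 1 ≤ Cφ :=
      calc |φ x| * min |N (u i x) - 1| 1 ≤ Cφ * 1 :=
            mul_le_mul (hCφ x) (min_le_right _ _) (by positivity) hCφ0
        _ = Cφ := mul_one _
    calc _ ≤ |φ x| * min |N (u i x) - 1| 1 * ((∑ j : Fin 2, ‖H j x‖) +
          ∑ j : Fin 2, ‖mollify (stdBump i) (H j) x - H j x‖) := by gcongr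
      _ ≤ _ := by
          rw [mul_add]
          gcongr
  have hfinal := le_of_tendsto_of_tendsto hlim1
    ((hlim2.add (hlim3.const_mul Cφ)).const_mul K) hle
  rw [mul_zero, add_zero] at hfinal
  have e1 : (fun x => fderiv ℝ φ x (F (w x))) =
      (Ω : Set Plane).indicator fun x => fderiv ℝ φ x (F (v x)) := by
    ext1 x
    by_cases hx : x ∈ (Ω : Set Plane)
    · simp [hw, hx]
    · rw [Set.indicator_of_notMem hx, fderiv_eq_zero_of_notMem φ hx, zero_apply]
  have e2 : (fun x => |φ x| * min |N (w x) - 1| 1 * ∑ j : Fin 2, ‖H j x‖) =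
      (Ω : Set Plane).indicator fun x => |φ x| * min |N (v x) - 1| 1 * ∑ j : Fin 2, ‖G j x‖ := by
    ext1 x
    by_cases hx : x ∈ (Ω : Set Plane)
    · simp [hw, hH, hx]
    · rw [Set.indicator_of_notMem hx, eq_zero_of_notMem φ hx, abs_zero, zero_mul, zero_mul]
  rw [e1, e2, integral_indicator hΩm, integral_indicator hΩm] at hfinal
  exact hfinal

end EntropyProduction

/-! ### Test functions and signed measures -/

section SignedMeasures

open scoped Manifold in
lemma exists_testFunction_one_on {Ω : Opens Plane} {K V : Set Plane} (hK : IsCompact K)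
    (hV : IsOpen V) (hKV : K ⊆ V) (hVΩ : V ⊆ Ω) :
    ∃ φ : 𝓓(Ω, ℝ), (∀ x ∈ K, φ x = 1) ∧ (∀ x, 0 ≤ φ x ∧ φ x ≤ 1) ∧ ∀ x ∉ V, φ x = 0 := by
  obtain ⟨δ, hδ, hδV⟩ := hK.exists_cthickening_subset_open hV hKV
  obtain ⟨f, hf, hf01, hfs, hf1⟩ := exists_contMDiff_support_eq_eq_one_iff (n := ⊤)
    𝓘(ℝ, Plane) (Metric.isOpen_thickening (δ := δ)) hK.isClosed (Metric.self_subset_thickening hδ K)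
  have hts : tsupport f ⊆ Metric.cthickening δ K := by
    rw [tsupport, hfs]
    exact Metric.closure_thickening_subset_cthickening δ K
  refine ⟨⟨f, contMDiff_iff_contDiff.1 hf, hK.cthickening.of_isClosed_subset (isClosed_tsupport f)
    hts, hts.trans (hδV.trans hVΩ)⟩, fun x hx => (hf1 x).1 hx,
    fun x => hf01 (Set.mem_range_self x), fun x hx => ?_⟩
  exact image_eq_zero_of_notMem_tsupport fun h => hx (hδV (hts h))

lemma integrable_testFunction {Ω : Opens Plane} (φ : 𝓓(Ω, ℝ)) (μ : Measure Plane)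
    [IsFiniteMeasure μ] : Integrable φ μ :=
  φ.continuous.integrable_of_hasCompactSupport φ.hasCompactSupport

/-- If `P - Q` is bounded by `ν` as a distribution, then `P ≤ ν` on the sets of `Q`-measure zero. -/
lemma measure_le_of_abs_integral_sub_le {Ω : Opens Plane} {P Q ν : Measure Plane}
    [IsFiniteMeasure P] [IsFiniteMeasure Q] [IsFiniteMeasure ν]
    (h : ∀ φ : 𝓓(Ω, ℝ), |∫ x, φ x ∂P - ∫ x, φ x ∂Q| ≤ ∫ x, |φ x| ∂ν)
    {E : Set Plane} (hE : MeasurableSet E) (hEΩ : E ⊆ Ω) (hQ : Q E = 0) : P E ≤ ν E := by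
  refine le_of_forall_lt fun c hc => ?_
  obtain ⟨K, hKE, hK, hcK⟩ := hE.exists_lt_isCompact hc
  refine hcK.trans_le (le_trans ?_ (measure_mono hKE))
  refine ENNReal.le_of_forall_pos_le_add fun δ hδ _ => ?_
  have hδ' : (δ / 2 : ENNReal) ≠ 0 := by simpa using hδ.ne'
  have hQK : Q K = 0 := measure_mono_null hKE hQ
  obtain ⟨V₁, hKV₁, hV₁, hQV₁⟩ := K.exists_isOpen_lt_add (measure_ne_top Q K) hδ'
  obtain ⟨V₂, hKV₂, hV₂, hνV₂⟩ := K.exists_isOpen_lt_add (measure_ne_top ν K) hδ'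
  set V := V₁ ∩ V₂ ∩ Ω with hVdef
  have hV : IsOpen V := (hV₁.inter hV₂).inter Ω.isOpen
  obtain ⟨φ, hφ1, hφ01, hφ0⟩ := exists_testFunction_one_on (Ω := Ω) hK hV
    (Set.subset_inter (Set.subset_inter hKV₁ hKV₂) (hKE.trans hEΩ)) Set.inter_subset_right
  have hup : ∀ (μ : Measure Plane) [IsFiniteMeasure μ], ∫ x, φ x ∂μ ≤ μ.real V := by
    intro μ _
    rw [← integral_indicator_one hV.measurableSet]
    refine integral_mono (integrable_testFunction φ μ)
      ((integrable_const (1 : ℝ)).indicator hV.measurableSet) fun x => ?_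
    by_cases hx : x ∈ V
    · simpa [hx] using (hφ01 x).2
    · simp [hx, hφ0 x hx]
  have hlow : P.real K ≤ ∫ x, φ x ∂P := by
    rw [← integral_indicator_one hK.measurableSet]
    refine integral_mono ((integrable_const (1 : ℝ)).indicator hK.measurableSet)
      (integrable_testFunction φ P) fun x => ?_
    by_cases hx : x ∈ K
    · simp [hx, hφ1 x hx]
    · simpa [hx] using (hφ01 x).1
  have habs : ∫ x, |φ x| ∂ν = ∫ x, φ x ∂ν :=
    integral_congr_ae (Eventually.of_forall fun x => abs_of_nonneg (hφ01 x).1)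
  have h1 := (le_abs_self _).trans (h φ)
  rw [habs] at h1
  have h2 : P.real K ≤ ν.real V + Q.real V := by
    have := hup ν
    have := hup Q
    linarith
  have h3 : P K ≤ ν V + Q V := by
    rw [← ofReal_measureReal (μ := P), ← ofReal_measureReal (μ := ν),
      ← ofReal_measureReal (μ := Q), ← ENNReal.ofReal_add measureReal_nonneg measureReal_nonneg]
    exact ENNReal.ofReal_le_ofReal h2
  calc P K ≤ ν V + Q V := h3
    _ ≤ ν V₂ + Q V₁ := by
        gcongr
        · exact fun x hx => hx.1.2
        · exact fun x hx => hx.1.1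
    _ ≤ (ν K + δ / 2) + (Q K + δ / 2) := add_le_add hνV₂.le hQV₁.le
    _ = ν K + δ := by rw [hQK, zero_add, add_assoc, ENNReal.add_halves]

/-- The total variation of a signed measure which is bounded by `ν` as a distribution on `Ω` is at
most `ν` on `Ω`. -/
theorem totalVariation_restrict_le {Ω : Opens Plane} {μ : SignedMeasure Plane} {ν : Measure Plane}
    [IsFiniteMeasure ν]
    (h : ∀ φ : 𝓓(Ω, ℝ), |∫ x, φ x ∂μ.toJordanDecomposition.posPart -
      ∫ x, φ x ∂μ.toJordanDecomposition.negPart| ≤ ∫ x, |φ x| ∂ν) :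
    μ.totalVariation.restrict Ω ≤ ν := by
  set P := μ.toJordanDecomposition.posPart
  set Q := μ.toJordanDecomposition.negPart
  obtain ⟨s, hs, hPs, hQs⟩ := μ.toJordanDecomposition.mutuallySingular
  refine Measure.le_iff.2 fun E hE => ?_
  rw [Measure.restrict_apply hE]
  set A := E ∩ Ω with hA
  have hAm : MeasurableSet A := hE.inter Ω.isOpen.measurableSet
  have hP : P (A \ s) ≤ ν (A \ s) := measure_le_of_abs_integral_sub_le h (hAm.diff hs)
    (fun x hx => hx.1.2) (measure_mono_null (fun x hx => hx.2) hQs)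
  have hQ : Q (A ∩ s) ≤ ν (A ∩ s) :=
    measure_le_of_abs_integral_sub_le (fun φ => by rw [abs_sub_comm]; exact h φ) (hAm.inter hs)
      (fun x hx => hx.1.2) (measure_mono_null (fun x hx => hx.2) hPs)
  have hP' : P A = P (A \ s) := by
    rw [← measure_inter_add_sdiff A hs,
      measure_mono_null (fun x hx => hx.2) hPs, zero_add]
  have hQ' : Q A = Q (A ∩ s) := by
    have h0 : Q (A \ s) = 0 := measure_mono_null (fun x hx => hx.2) hQs
    rw [← measure_inter_add_sdiff A hs, h0, add_zero]
  calc μ.totalVariation A = P A + Q A := rfl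
    _ ≤ ν (A \ s) + ν (A ∩ s) := by rw [hP', hQ']; exact add_le_add hP hQ
    _ = ν A := by rw [add_comm, measure_inter_add_sdiff A hs]
    _ ≤ ν E := measure_mono Set.inter_subset_left

/-- A measure which bounds every member of a family on `U` bounds its supremum on `U`. -/
lemma sSup_measure_apply_le {X : Type*} [MeasurableSpace X] {S : Set (Measure X)}
    {κ : Measure X} {U : Set X} (hU : MeasurableSet U) (h : ∀ μ ∈ S, μ.restrict U ≤ κ) :
    sSup S U ≤ κ U := by
  have hle : sSup S ≤ κ.restrict U + (sSup S).restrict Uᶜ := by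
    refine sSup_le fun μ hμ => ?_
    rw [← Measure.restrict_add_restrict_compl (μ := μ) hU]
    refine add_le_add ?_ (Measure.restrict_mono le_rfl (le_sSup hμ))
    have := Measure.restrict_mono (s := U) le_rfl (h μ hμ)
    rwa [Measure.restrict_restrict hU, Set.inter_self] at this
  calc sSup S U ≤ (κ.restrict U + (sSup S).restrict Uᶜ) U := hle U
    _ = κ U := by
        rw [Measure.add_apply, Measure.restrict_apply_self, Measure.restrict_apply hU,
          Set.inter_compl_self, measure_empty, add_zero]

/-- The signed measure with density `h` with respect to `κ`, with its Jordan decomposition. -/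
lemma exists_signedMeasure_of_density {κ : Measure Plane} [IsFiniteMeasure κ] {h : Plane → ℝ}
    (hm : Measurable h) (hi : Integrable h κ) :
    ∃ μ : SignedMeasure Plane, μ.totalVariation ≪ κ ∧
      ∀ φ : Plane → ℝ, Continuous φ → (∃ C, ∀ x, ‖φ x‖ ≤ C) →
        ∫ x, φ x ∂μ.toJordanDecomposition.posPart - ∫ x, φ x ∂μ.toJordanDecomposition.negPart =
          ∫ x, h x * φ x ∂κ := by
  have hpos : IsFiniteMeasure (κ.withDensity fun x => ENNReal.ofReal (h x)) :=
    isFiniteMeasure_withDensity_ofReal hi.2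
  have hneg : IsFiniteMeasure (κ.withDensity fun x => ENNReal.ofReal (-h x)) :=
    isFiniteMeasure_withDensity_ofReal hi.neg.2
  let j : JordanDecomposition Plane :=
    { posPart := κ.withDensity fun x => ENNReal.ofReal (h x)
      negPart := κ.withDensity fun x => ENNReal.ofReal (-h x)
      mutuallySingular := withDensity_ofReal_mutuallySingular hm }
  have hj : j.toSignedMeasure.toJordanDecomposition = j :=
    SignedMeasure.toJordanDecomposition_eq rfl
  refine ⟨j.toSignedMeasure, ?_, fun φ hφ hφb => ?_⟩
  · rw [SignedMeasure.totalVariation, hj]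
    exact (withDensity_absolutelyContinuous κ _).add_left (withDensity_absolutelyContinuous κ _)
  · obtain ⟨C, hC⟩ := hφb
    rw [hj]
    have e : ∀ g : Plane → ℝ, Measurable g →
        ∫ x, φ x ∂(κ.withDensity fun x => ENNReal.ofReal (g x)) = ∫ x, max (g x) 0 * φ x ∂κ := by
      intro g hg
      rw [integral_withDensity_eq_integral_toReal_smul (by fun_prop)
        (Eventually.of_forall fun _ => ENNReal.ofReal_lt_top)]
      simp only [ENNReal.toReal_ofReal', smul_eq_mul]
    have i : ∀ g : Plane → ℝ, Integrable g κ → Integrable (fun x => max (g x) 0 * φ x) κ := by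
      intro g hg
      exact hg.pos_part.mul_bdd hφ.aestronglyMeasurable (Eventually.of_forall hC)
    show ∫ x, φ x ∂(κ.withDensity fun x => ENNReal.ofReal (h x)) -
      ∫ x, φ x ∂(κ.withDensity fun x => ENNReal.ofReal (-h x)) = _
    rw [e h hm, e (fun x => -h x) hm.neg, ← integral_sub (i h hi) (i (fun x => -h x) hi.neg)]
    refine integral_congr_ae (Eventually.of_forall fun x => ?_)
    show max (h x) 0 * φ x - max (-h x) 0 * φ x = h x * φ x
    rw [← sub_mul, max_zero_sub_eq_self]

/-- A distribution on `Ω` bounded by the finite measure `ν` is a finite signed measure. It extends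
by Hahn-Banach to a bounded functional on `L²(ν)`, which has a density by the Fréchet-Riesz
theorem. -/
theorem exists_signedMeasure_of_abs_le {Ω : Opens Plane} {ν : Measure Plane} [IsFiniteMeasure ν]
    {C : ℝ} (T : 𝓓(Ω, ℝ) →ₗ[ℝ] ℝ) (hT : ∀ φ, |T φ| ≤ C * ∫ x, |φ x| ∂ν) :
    ∃ μ : SignedMeasure Plane, μ.totalVariation (Ω : Set Plane)ᶜ = 0 ∧
      ∀ φ : 𝓓(Ω, ℝ), T φ = ∫ x, φ x ∂μ.toJordanDecomposition.posPart -
        ∫ x, φ x ∂μ.toJordanDecomposition.negPart := by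
  have hΩm := Ω.isOpen.measurableSet
  set κ := ν.restrict (Ω : Set Plane) with hκ
  have hbdd : ∀ φ : 𝓓(Ω, ℝ), ∃ B, ∀ x, ‖φ x‖ ≤ B := fun φ =>
    φ.continuous.bounded_above_of_compact_support φ.hasCompactSupport
  have hmem : ∀ φ : 𝓓(Ω, ℝ), MemLp φ 2 κ := fun φ => by
    obtain ⟨B, hB⟩ := hbdd φ
    exact MemLp.of_bound φ.continuous.aestronglyMeasurable B (Eventually.of_forall hB)
  let p : 𝓓(Ω, ℝ) →ₗ[ℝ] Lp ℝ 2 κ :=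
    { toFun := fun φ => (hmem φ).toLp φ
      map_add' := fun φ ψ => MemLp.toLp_add (hmem φ) (hmem ψ)
      map_smul' := fun c φ => MemLp.toLp_const_smul c (hmem φ) }
  -- Cauchy-Schwarz
  set B := |C| * (κ Set.univ).toReal ^ (1 / 2 : ℝ) with hB
  have hTp : ∀ φ, |T φ| ≤ B * ‖p φ‖ := by
    intro φ
    have h1 : ∫ x, |φ x| ∂ν = ∫ x, |φ x| ∂κ := by
      rw [hκ, ← integral_indicator hΩm]
      congr 1
      ext1 x
      by_cases hx : x ∈ (Ω : Set Plane)
      · simp [hx]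
      · rw [Set.indicator_of_notMem hx, eq_zero_of_notMem φ hx, abs_zero]
    have h2 : ∫ x, |φ x| ∂κ ≤ (κ Set.univ).toReal ^ (1 / 2 : ℝ) * ‖p φ‖ := by
      have h3 := eLpNorm_le_eLpNorm_mul_rpow_measure_univ (μ := κ) (p := 1) (q := 2)
        (by norm_num) φ.continuous.aestronglyMeasurable
      have h4 : ∫ x, |φ x| ∂κ = (eLpNorm φ 1 κ).toReal := by
        rw [eLpNorm_one_eq_lintegral_enorm]
        exact integral_norm_eq_lintegral_enorm φ.continuous.aestronglyMeasurable
      have h5 : ‖p φ‖ = (eLpNorm φ 2 κ).toReal := Lp.norm_toLp _ (hmem φ)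
      rw [h4, h5, ENNReal.toReal_rpow, ← ENNReal.toReal_mul, mul_comm]
      refine ENNReal.toReal_mono (ENNReal.mul_ne_top (hmem φ).2.ne
        (ENNReal.rpow_ne_top_of_nonneg (by norm_num) (measure_ne_top κ _))) ?_
      convert h3 using 3
      norm_num
    calc |T φ| ≤ C * ∫ x, |φ x| ∂κ := h1 ▸ hT φ
      _ ≤ |C| * ∫ x, |φ x| ∂κ := by gcongr; exact le_abs_self C
      _ ≤ |C| * ((κ Set.univ).toReal ^ (1 / 2 : ℝ) * ‖p φ‖) := by gcongr
      _ = B * ‖p φ‖ := by rw [hB]; ring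
  have hker : LinearMap.ker p ≤ LinearMap.ker T := by
    intro φ hφ
    rw [LinearMap.mem_ker] at hφ ⊢
    have := hTp φ
    rw [hφ, norm_zero, mul_zero] at this
    exact abs_nonpos_iff.1 this
  let f₀ : LinearMap.range p →ₗ[ℝ] ℝ :=
    ((LinearMap.ker p).liftQ T hker).comp p.quotKerEquivRange.symm.toLinearMap
  have hf₀ : ∀ φ, f₀ ⟨p φ, LinearMap.mem_range_self p φ⟩ = T φ := by
    intro φ
    have : p.quotKerEquivRange.symm ⟨p φ, LinearMap.mem_range_self p φ⟩ =
        (LinearMap.ker p).mkQ φ := p.quotKerEquivRange_symm_apply_image φ _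
    simp [f₀, this]
  let f : LinearMap.range p →L[ℝ] ℝ := f₀.mkContinuous B (by
    rintro ⟨_, φ, rfl⟩
    rw [hf₀]
    exact hTp φ)
  obtain ⟨g, hg, -⟩ := exists_extension_norm_eq (LinearMap.range p) f
  set h : Lp ℝ 2 κ := (InnerProductSpace.toDual ℝ (Lp ℝ 2 κ)).symm g with hh
  have hTh : ∀ φ, T φ = ∫ x, h x * φ x ∂κ := by
    intro φ
    have h1 : g (p φ) = T φ := by
      rw [← hf₀ φ]
      exact hg ⟨p φ, LinearMap.mem_range_self p φ⟩
    rw [← h1, ← InnerProductSpace.toDual_symm_apply, L2.inner_def]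
    refine integral_congr_ae ?_
    filter_upwards [(hmem φ).coeFn_toLp] with x hx
    have : (p φ : Plane → ℝ) x = φ x := hx
    simp only [this]
    simp [hh, mul_comm]
  obtain ⟨μ, hμ, hμφ⟩ := exists_signedMeasure_of_density (κ := κ) (h := h)
    (Lp.stronglyMeasurable h).measurable ((Lp.memLp h).integrable (by norm_num))
  refine ⟨μ, hμ ?_, fun φ => ?_⟩
  · rw [hκ, Measure.restrict_apply hΩm.compl, Set.compl_inter_self, measure_empty]
  · rw [hμφ φ φ.continuous (hbdd φ), hTh φ]

end SignedMeasures

/-! ### Weak limits of measures along an ultrafilter -/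

open scoped CompactlySupported in
/-- Measures of bounded mass converge weakly along every ultrafilter, by the
Riesz-Markov-Kakutani theorem. Mass on open sets does not increase in the limit. -/
theorem exists_weak_limit (𝓤 : Ultrafilter ℕ) (ρ : ℕ → Measure Plane) {M : ℝ≥0∞} (hM : M ≠ ∞)
    (hρ : ∀ n, ρ n Set.univ ≤ M) :
    ∃ ν : Measure Plane, IsFiniteMeasure ν ∧
      (∀ f : Plane → ℝ, Continuous f → HasCompactSupport f →
        Tendsto (fun n => ∫ x, f x ∂ρ n) 𝓤 (𝓝 (∫ x, f x ∂ν))) ∧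
      ∀ U : Set Plane, IsOpen U → ∀ c : ℝ≥0∞, c ≠ ∞ → (∀ᶠ n in 𝓤, ρ n U ≤ c) → ν U ≤ c := by
  have hfin : ∀ n, IsFiniteMeasure (ρ n) := fun n => ⟨(hρ n).trans_lt hM.lt_top⟩
  have hint : ∀ (f : C_c(Plane, ℝ)) n, Integrable f (ρ n) := fun f n =>
    f.continuous.integrable_of_hasCompactSupport f.hasCompactSupport
  have hex : ∀ f : C_c(Plane, ℝ), ∃ l, Tendsto (fun n => ∫ x, f x ∂ρ n) 𝓤 (𝓝 l) := by
    intro f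
    obtain ⟨C, hC⟩ := f.continuous.bounded_above_of_compact_support f.hasCompactSupport
    have hC0 : 0 ≤ C := (norm_nonneg _).trans (hC 0)
    have hb : ∀ n, ∫ x, f x ∂ρ n ∈ Set.Icc (-(C * M.toReal)) (C * M.toReal) := by
      intro n
      rw [Set.mem_Icc, ← abs_le]
      refine (norm_integral_le_of_norm_le_const (Eventually.of_forall hC)).trans ?_
      gcongr
      exact ENNReal.toReal_mono hM (hρ n)
    obtain ⟨l, -, hl⟩ := isCompact_Icc.ultrafilter_le_nhds' (𝓤.map fun n => ∫ x, f x ∂ρ n)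
      (Eventually.of_forall hb : ∀ᶠ n in (𝓤 : Filter ℕ), _)
    exact ⟨l, hl⟩
  choose l hl using hex
  let Λ₀ : C_c(Plane, ℝ) →ₗ[ℝ] ℝ :=
    { toFun := l
      map_add' := fun f g => by
        refine tendsto_nhds_unique (hl (f + g)) (((hl f).add (hl g)).congr fun n => ?_)
        exact (integral_add (hint f n) (hint g n)).symm
      map_smul' := fun c f => by
        refine tendsto_nhds_unique (hl (c • f)) (((hl f).const_mul c).congr fun n => ?_)
        exact (integral_const_mul c _).symm }
  let Λ : C_c(Plane, ℝ) →ₚ[ℝ] ℝ := PositiveLinearMap.mk₀ Λ₀ fun f hf =>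
    ge_of_tendsto' (hl f) fun n => integral_nonneg fun x => hf x
  have hΛ : ∀ f, Λ f = l f := fun f => rfl
  have hopen : ∀ U : Set Plane, IsOpen U → ∀ c : ℝ≥0∞, c ≠ ∞ → (∀ᶠ n in 𝓤, ρ n U ≤ c) →
      RealRMK.rieszMeasure Λ U ≤ c := by
    intro U hU c hc hUc
    rw [hU.measure_eq_iSup_isCompact]
    refine iSup₂_le fun K hKU => iSup_le fun hK => ?_
    obtain ⟨f, hf1, hf0, hfc, hf01⟩ := exists_continuous_one_zero_of_isCompact hK hU.isClosed_compl
      (Set.disjoint_compl_right_iff_subset.2 hKU)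
    let f' : C_c(Plane, ℝ) := ⟨f, hfc⟩
    refine (RealRMK.rieszMeasure_le_of_eq_one Λ (f := f') (fun x => (hf01 x).1) hK
      fun x hx => hf1 hx).trans ?_
    rw [hΛ]
    refine ENNReal.ofReal_le_of_le_toReal (le_of_tendsto (hl f') ?_)
    filter_upwards [hUc] with n hn
    calc ∫ x, f x ∂ρ n ≤ ∫ x, U.indicator 1 x ∂ρ n := by
          refine integral_mono (hint f' n) ((integrable_const (1 : ℝ)).indicator hU.measurableSet)
            fun x => ?_
          by_cases hx : x ∈ U
          · simpa [hx] using (hf01 x).2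
          · simpa [hx] using (hf0 hx).le
      _ = (ρ n).real U := integral_indicator_one hU.measurableSet
      _ ≤ c.toReal := ENNReal.toReal_mono hc hn
  refine ⟨RealRMK.rieszMeasure Λ, ⟨?_⟩, fun f hf hfc => ?_, hopen⟩
  · exact (hopen Set.univ isOpen_univ M hM (Eventually.of_forall hρ)).trans_lt hM.lt_top
  · let f' : C_c(Plane, ℝ) := ⟨⟨f, hf⟩, hfc⟩
    have h1 : ∫ x, f x ∂(RealRMK.rieszMeasure Λ) = l f' := RealRMK.integral_rieszMeasure Λ f'
    rw [h1]
    exact hl f'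

/-! ### Energy densities -/

section Energy

variable {N : Seminorm ℝ Plane}

/-- The measure on `Ω` whose density is the energy density of `v`. -/
noncomputable def energyMeasure (N : Seminorm ℝ Plane) (Ω : Opens Plane) (ε : ℝ)
    (v : Plane → Plane) (G : Fin 2 → Plane → Plane) : Measure Plane :=
  (volume.restrict (Ω : Set Plane)).withDensity fun x =>
    ENNReal.ofReal (ε * ∑ j, ‖G j x‖ ^ 2 + 1 / ε * (1 - N (v x) ^ 2) ^ 2)

lemma energyMeasure_apply (Ω U : Opens Plane) (hU : U ≤ Ω) (ε : ℝ) (v : Plane → Plane)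
    (G : Fin 2 → Plane → Plane) :
    energyMeasure N Ω ε v G U = energy N ε v G U := by
  rw [energyMeasure, withDensity_apply _ U.isOpen.measurableSet,
    Measure.restrict_restrict U.isOpen.measurableSet, Set.inter_eq_left.2 hU, energy]

lemma energyMeasure_univ (Ω : Opens Plane) (ε : ℝ) (v : Plane → Plane)
    (G : Fin 2 → Plane → Plane) :
    energyMeasure N Ω ε v G Set.univ = energy N ε v G Ω := by
  rw [energyMeasure, withDensity_apply _ MeasurableSet.univ, Measure.restrict_univ, energy]

lemma min_abs_sub_one_mul_le (N : Seminorm ℝ Plane) {ε : ℝ} (hε : 0 < ε) (z : Plane)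
    (g : Fin 2 → Plane) :
    min |N z - 1| 1 * ∑ j, ‖g j‖ ≤ ε * ∑ j, ‖g j‖ ^ 2 + 1 / ε * (1 - N z ^ 2) ^ 2 := by
  have hN : 0 ≤ N z := apply_nonneg N z
  have h1 : min |N z - 1| 1 ≤ |1 - N z ^ 2| := by
    refine (min_le_left _ _).trans ?_
    have : 1 - N z ^ 2 = -((N z - 1) * (1 + N z)) := by ring
    rw [this, abs_neg, abs_mul, abs_of_nonneg (by positivity : 0 ≤ 1 + N z)]
    exact le_mul_of_one_le_right (abs_nonneg _) (by linarith)
  rw [← sq_abs (1 - N z ^ 2)]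
  set s := |1 - N z ^ 2|
  have hs : 0 ≤ s := abs_nonneg _
  simp only [Fin.sum_univ_two]
  set a := ‖g 0‖
  set b := ‖g 1‖
  have ha : 0 ≤ a := norm_nonneg _
  have hb : 0 ≤ b := norm_nonneg _
  have h2 : ε * (a ^ 2 + b ^ 2) + 1 / ε * s ^ 2 - s * (a + b) =
      ε * (a - s / (2 * ε)) ^ 2 + ε * (b - s / (2 * ε)) ^ 2 + s ^ 2 / (2 * ε) := by
    field_simp; ring
  have h3 : 0 ≤ ε * (a - s / (2 * ε)) ^ 2 + ε * (b - s / (2 * ε)) ^ 2 + s ^ 2 / (2 * ε) := by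
    positivity
  calc min |N z - 1| 1 * (a + b) ≤ s * (a + b) := by gcongr
    _ ≤ _ := by linarith

/-- The entropy production of a divergence free map is bounded by its energy. -/
theorem abs_integral_fderiv_comp_le_energyMeasure {Ω : Opens Plane}
    (hΩ : volume (Ω : Set Plane) ≠ ∞) {ε : ℝ} (hε : 0 < ε)
    {v : Plane → Plane} {G : Fin 2 → Plane → Plane} (hv : IsW12 Ω v G) (hdiv : DivFree Ω v)
    (hE : energy N ε v G Ω < ∞) {F : Plane → Plane} {α : Plane → ℝ} {K : ℝ}
    (hF : ContDiff ℝ 1 F) (hFc : HasCompactSupport F) (hK : 0 ≤ K)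
    (hα : ∀ z w, ‖fderiv ℝ F z w - α z • w‖ ≤ K * min |N z - 1| 1 * ‖w‖) (φ : 𝓓(Ω, ℝ)) :
    |∫ x in Ω, fderiv ℝ φ x (F (v x))| ≤ K * ∫ x, |φ x| ∂energyMeasure N Ω ε v G := by
  refine (abs_integral_fderiv_comp_le hΩ hv hdiv hF hFc hK hα φ).trans ?_
  gcongr
  set e : Plane → ℝ := fun x => ε * ∑ j, ‖G j x‖ ^ 2 + 1 / ε * (1 - N (v x) ^ 2) ^ 2 with he
  have he0 : ∀ x, 0 ≤ e x := fun x => by positivity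
  have hem : AEStronglyMeasurable e (volume.restrict (Ω : Set Plane)) := by
    have h1 : ∀ j, AEStronglyMeasurable (fun x => ‖G j x‖ ^ 2) (volume.restrict (Ω : Set Plane)) :=
      fun j => (hv.memLp_grad j).aestronglyMeasurable.norm.pow 2
    have h2 : AEStronglyMeasurable (fun x => N (v x)) (volume.restrict (Ω : Set Plane)) :=
      (continuous_seminorm_plane N).comp_aestronglyMeasurable hv.memLp.aestronglyMeasurable
    have h3 : AEStronglyMeasurable (fun x => ∑ j, ‖G j x‖ ^ 2)
        (volume.restrict (Ω : Set Plane)) := by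
      simp only [Fin.sum_univ_two]
      exact (h1 0).add (h1 1)
    exact (h3.const_mul ε).add (((aestronglyMeasurable_const.sub (h2.pow 2)).pow 2).const_mul (1 / ε))
  have hei : Integrable e (volume.restrict (Ω : Set Plane)) := by
    refine ⟨hem, ?_⟩
    rw [hasFiniteIntegral_iff_ofReal (Eventually.of_forall he0)]
    exact hE
  have h1 : ∫ x, |φ x| ∂energyMeasure N Ω ε v G = ∫ x in Ω, e x * |φ x| := by
    rw [energyMeasure, integral_withDensity_eq_integral_toReal_smul₀
      hem.aemeasurable.ennreal_ofReal (Eventually.of_forall fun _ => ENNReal.ofReal_lt_top)]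
    refine integral_congr_ae (Eventually.of_forall fun x => ?_)
    simp only [smul_eq_mul]
    rw [ENNReal.toReal_ofReal (he0 x)]
  rw [h1]
  obtain ⟨C, hC⟩ := φ.continuous.bounded_above_of_compact_support φ.hasCompactSupport
  refine integral_mono_of_nonneg (Eventually.of_forall fun x => by positivity)
    (hei.mul_bdd (c := C) φ.continuous.abs.aestronglyMeasurable
      (Eventually.of_forall fun x => by rw [Real.norm_eq_abs, abs_abs]; exact hC x))
    (Eventually.of_forall fun x => ?_)
  show |φ x| * min |N (v x) - 1| 1 * ∑ j : Fin 2, ‖G j x‖ ≤ e x * |φ x|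
  rw [mul_assoc, mul_comm (e x)]
  exact mul_le_mul_of_nonneg_left (min_abs_sub_one_mul_le N hε (v x) fun j => G j x) (abs_nonneg _)

end Energy

/-! ### Passage to the limit -/

section Limit

variable {N : Seminorm ℝ Plane} {Ω : Opens Plane} {m : Plane → Plane} {v : ℕ → Plane → Plane}
  {G : ℕ → Fin 2 → Plane → Plane} {ε : ℕ → ℝ}

lemma integrable_fderiv_apply (φ : 𝓓(Ω, ℝ)) {w : Plane → Plane} {μ : Measure Plane}
    (hw : Integrable w μ) : Integrable (fun x => fderiv ℝ φ x (w x)) μ := by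
  have hφ' : Continuous (fderiv ℝ φ) :=
    φ.contDiff.continuous_fderiv (by simp)
  obtain ⟨C, hC⟩ := hφ'.bounded_above_of_compact_support (φ.hasCompactSupport.fderiv ℝ)
  have hm : AEStronglyMeasurable (fun x => fderiv ℝ φ x (w x)) μ :=
    isBoundedBilinearMap_apply.continuous.comp_aestronglyMeasurable
      (hφ'.aestronglyMeasurable.prodMk hw.aestronglyMeasurable)
  refine (hw.norm.const_mul C).mono' hm (Eventually.of_forall fun x => ?_)
  exact ((fderiv ℝ φ x).le_opNorm _).trans (by gcongr; exact hC x)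

/-- Convergence of `∫ ∇φ · F(vₙ)` for Lipschitz `F`, when `vₙ → m` in `L²(Ω)`. -/
lemma tendsto_integral_fderiv_comp (hΩ : volume (Ω : Set Plane) ≠ ∞)
    (hv : ∀ n, MemLp (v n) 2 (volume.restrict (Ω : Set Plane)))
    (hm : MemLp m 2 (volume.restrict (Ω : Set Plane)))
    (hlim : Tendsto (fun n => eLpNorm (v n - m) 2 (volume.restrict (Ω : Set Plane))) atTop (𝓝 0))
    {F : Plane → Plane} {L : NNReal} (hF : LipschitzWith L F) (φ : 𝓓(Ω, ℝ)) :
    Tendsto (fun n => ∫ x in Ω, fderiv ℝ φ x (F (v n x))) atTop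
      (𝓝 (∫ x in Ω, fderiv ℝ φ x (F (m x)))) := by
  have : IsFiniteMeasure (volume.restrict (Ω : Set Plane)) :=
    ⟨by rw [Measure.restrict_apply_univ]; exact hΩ.lt_top⟩
  have hFi : ∀ w : Plane → Plane, MemLp w 2 (volume.restrict (Ω : Set Plane)) →
      Integrable (fun x => F (w x)) (volume.restrict (Ω : Set Plane)) := by
    intro w hw
    refine (((hw.integrable (by norm_num)).norm.const_mul L).add
      (integrable_const ‖F 0‖)).mono'
      (hF.continuous.comp_aestronglyMeasurable hw.aestronglyMeasurable)
      (Eventually.of_forall fun x => ?_)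
    have h1 := hF.norm_sub_le (w x) 0
    rw [sub_zero] at h1
    have h2 := norm_le_norm_add_norm_sub' (F (w x)) (F 0)
    show ‖F (w x)‖ ≤ L * ‖w x‖ + ‖F 0‖
    linarith
  have hφ' : Continuous (fderiv ℝ φ) :=
    φ.contDiff.continuous_fderiv (by simp)
  obtain ⟨C, hC⟩ := hφ'.bounded_above_of_compact_support (φ.hasCompactSupport.fderiv ℝ)
  have hC0 : 0 ≤ C := (norm_nonneg _).trans (hC 0)
  have hL1 : Tendsto (fun n => eLpNorm (v n - m) 1 (volume.restrict (Ω : Set Plane))) atTop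
      (𝓝 0) := by
    set V := (volume.restrict (Ω : Set Plane)) Set.univ ^
      (1 / (1 : ℝ≥0∞).toReal - 1 / (2 : ℝ≥0∞).toReal) with hV
    have hVt : V ≠ ∞ := ENNReal.rpow_ne_top_of_nonneg (by norm_num) (measure_ne_top _ _)
    have h0 := ENNReal.Tendsto.mul_const hlim (Or.inr hVt)
    rw [zero_mul] at h0
    exact tendsto_of_tendsto_of_tendsto_of_le_of_le tendsto_const_nhds h0 (fun _ => zero_le)
      fun n => eLpNorm_le_eLpNorm_mul_rpow_measure_univ (by norm_num)
        ((hv n).aestronglyMeasurable.sub hm.aestronglyMeasurable)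
  refine tendsto_integral_of_L1' _ (integrable_fderiv_apply φ (hFi m hm)).aestronglyMeasurable
    (Eventually.of_forall fun n => integrable_fderiv_apply φ (hFi (v n) (hv n))) ?_
  have hup := ENNReal.Tendsto.const_mul (a := ENNReal.ofReal (C * L)) hL1
    (Or.inr ENNReal.ofReal_ne_top)
  rw [mul_zero] at hup
  refine tendsto_of_tendsto_of_tendsto_of_le_of_le tendsto_const_nhds hup (fun _ => zero_le)
    fun n => ?_
  refine eLpNorm_le_mul_eLpNorm_of_ae_le_mul (Eventually.of_forall fun x => ?_) 1
  simp only [Pi.sub_apply, ← map_sub]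
  calc ‖fderiv ℝ φ x (F (v n x) - F (m x))‖ ≤ ‖fderiv ℝ φ x‖ * ‖F (v n x) - F (m x)‖ :=
        (fderiv ℝ φ x).le_opNorm _
    _ ≤ C * (L * ‖v n x - m x‖) := by
        gcongr
        · exact hC x
        · exact hF.norm_sub_le _ _
    _ = C * L * ‖v n x - m x‖ := by ring

lemma divFree_of_tendsto (hΩ : volume (Ω : Set Plane) ≠ ∞)
    (hv : ∀ n, MemLp (v n) 2 (volume.restrict (Ω : Set Plane)))
    (hm : MemLp m 2 (volume.restrict (Ω : Set Plane)))
    (hlim : Tendsto (fun n => eLpNorm (v n - m) 2 (volume.restrict (Ω : Set Plane))) atTop (𝓝 0))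
    (hdiv : ∀ n, DivFree Ω (v n)) : DivFree Ω m := by
  intro φ
  have h := tendsto_integral_fderiv_comp hΩ hv hm hlim LipschitzWith.id φ
  simp only [id, hdiv _ φ] at h
  exact (tendsto_nhds_unique h tendsto_const_nhds)

/-- The limit takes values in the unit circle, by Fatou's lemma. -/
lemma ae_map_eq_one_of_tendsto (hε : ∀ n, 0 < ε n) (hε0 : Tendsto ε atTop (𝓝 0))
    (hv : ∀ n, MemLp (v n) 2 (volume.restrict (Ω : Set Plane)))
    (hm : MemLp m 2 (volume.restrict (Ω : Set Plane)))
    (hlim : Tendsto (fun n => eLpNorm (v n - m) 2 (volume.restrict (Ω : Set Plane))) atTop (𝓝 0))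
    (hE : (⨆ n, energy N (ε n) (v n) (G n) Ω) < ∞) :
    ∀ᵐ x ∂(volume.restrict (Ω : Set Plane)), N (m x) = 1 := by
  set M := ⨆ n, energy N (ε n) (v n) (G n) Ω with hM
  have hN := continuous_seminorm_plane N
  let q : Plane → ℝ≥0∞ := fun z => ENNReal.ofReal ((1 - N z ^ 2) ^ 2)
  have hq : Continuous q := by
    refine ENNReal.continuous_ofReal.comp ?_
    exact (continuous_const.sub (hN.pow 2)).pow 2
  have hle : ∀ n, ∫⁻ x in Ω, q (v n x) ≤ ENNReal.ofReal (ε n) * M := by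
    intro n
    calc ∫⁻ x in Ω, q (v n x) ≤ ∫⁻ x in Ω, ENNReal.ofReal (ε n) *
          ENNReal.ofReal (ε n * ∑ j, ‖G n j x‖ ^ 2 + 1 / ε n * (1 - N (v n x) ^ 2) ^ 2) := by
          refine lintegral_mono fun x => ?_
          rw [← ENNReal.ofReal_mul (hε n).le]
          refine ENNReal.ofReal_le_ofReal ?_
          have h1 : ε n * (ε n * ∑ j, ‖G n j x‖ ^ 2 + 1 / ε n * (1 - N (v n x) ^ 2) ^ 2) =
              ε n ^ 2 * ∑ j, ‖G n j x‖ ^ 2 + (1 - N (v n x) ^ 2) ^ 2 := by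
            have := (hε n).ne'
            field_simp
          rw [h1]
          have : 0 ≤ ε n ^ 2 * ∑ j, ‖G n j x‖ ^ 2 := by positivity
          linarith
      _ = ENNReal.ofReal (ε n) * energy N (ε n) (v n) (G n) Ω :=
          lintegral_const_mul' _ _ ENNReal.ofReal_ne_top
      _ ≤ _ := by
          gcongr
          exact le_iSup (fun n => energy N (ε n) (v n) (G n) Ω) n
  have hlim0 : Tendsto (fun n => ∫⁻ x in Ω, q (v n x)) atTop (𝓝 0) := by
    have h0 := ENNReal.Tendsto.mul_const
      ((ENNReal.continuous_ofReal.tendsto 0).comp hε0) (Or.inr hE.ne)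
    rw [ENNReal.ofReal_zero, zero_mul] at h0
    exact tendsto_of_tendsto_of_tendsto_of_le_of_le tendsto_const_nhds h0 (fun _ => zero_le) hle
  obtain ⟨ns, hns, hae⟩ := (tendstoInMeasure_of_tendsto_eLpNorm (by norm_num)
    (fun n => (hv n).aestronglyMeasurable) hm.aestronglyMeasurable hlim).exists_seq_tendsto_ae
  have hqm : AEMeasurable (fun x => q (m x)) (volume.restrict (Ω : Set Plane)) :=
    hq.measurable.comp_aemeasurable hm.aestronglyMeasurable.aemeasurable
  have hfatou : ∫⁻ x in Ω, q (m x) ≤ 0 :=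
    calc ∫⁻ x in Ω, q (m x) ≤ ∫⁻ x in Ω, liminf (fun i => q (v (ns i) x)) atTop := by
          refine lintegral_mono_ae ?_
          filter_upwards [hae] with x hx
          exact ((hq.tendsto _).comp hx).liminf_eq.ge
      _ ≤ liminf (fun i => ∫⁻ x in Ω, q (v (ns i) x)) atTop :=
          lintegral_liminf_le' fun i =>
            hq.measurable.comp_aemeasurable (hv (ns i)).aestronglyMeasurable.aemeasurable
      _ = 0 := (hlim0.comp hns.tendsto_atTop).liminf_eq
  have h0 := (lintegral_eq_zero_iff' hqm).1 (le_antisymm hfatou zero_le)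
  filter_upwards [h0] with x hx
  have h1 : (1 - N (m x) ^ 2) ^ 2 ≤ 0 := ENNReal.ofReal_eq_zero.1 hx
  have h2 : 0 ≤ N (m x) := apply_nonneg N _
  have h3 : 1 - N (m x) ^ 2 = 0 := pow_eq_zero_iff two_ne_zero |>.1 (le_antisymm h1 (sq_nonneg _))
  nlinarith

/-- `Φ(m)` is integrable, and `∫ ∇φ · Φ(m)` does not change if an affine map `z ↦ c z + p` is
subtracted from `Φ`, since `m` is divergence free. -/
lemma integral_fderiv_entropy_eq (hΩ : volume (Ω : Set Plane) ≠ ∞)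
    (hm : MemLp m 2 (volume.restrict (Ω : Set Plane)))
    (hm1 : ∀ᵐ x ∂(volume.restrict (Ω : Set Plane)), N (m x) = 1) (hdiv : DivFree Ω m)
    {F Φ : Plane → Plane} (hF : ContDiff ℝ 1 F) (hFc : HasCompactSupport F) {c : ℝ} {p : Plane}
    (hFΦ : ∀ z, N z = 1 → F z = Φ z - c • z - p) :
    Integrable (fun x => Φ (m x)) (volume.restrict (Ω : Set Plane)) ∧ ∀ φ : 𝓓(Ω, ℝ),
      ∫ x in Ω, fderiv ℝ φ x (Φ (m x)) = ∫ x in Ω, fderiv ℝ φ x (F (m x)) := by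
  have : IsFiniteMeasure (volume.restrict (Ω : Set Plane)) :=
    ⟨by rw [Measure.restrict_apply_univ]; exact hΩ.lt_top⟩
  obtain ⟨B, hB⟩ := hF.continuous.bounded_above_of_compact_support hFc
  have hmi : Integrable m (volume.restrict (Ω : Set Plane)) := hm.integrable (by norm_num)
  have i1 : Integrable (fun x => F (m x)) (volume.restrict (Ω : Set Plane)) :=
    Integrable.of_bound (hF.continuous.comp_aestronglyMeasurable hm.aestronglyMeasurable) B
      (Eventually.of_forall fun x => hB _)
  have i2 : Integrable (fun x => c • m x) (volume.restrict (Ω : Set Plane)) := hmi.smul c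
  have i3 : Integrable (fun _ => p) (volume.restrict (Ω : Set Plane)) := integrable_const p
  have hae : ∀ᵐ x ∂(volume.restrict (Ω : Set Plane)), F (m x) + c • m x + p = Φ (m x) := by
    filter_upwards [hm1] with x hx
    rw [hFΦ _ hx]; abel
  refine ⟨((i1.add i2).add i3).congr hae, fun φ => ?_⟩
  have h1 : ∫ x in Ω, fderiv ℝ φ x (Φ (m x)) = ∫ x in Ω, (fderiv ℝ φ x (F (m x)) +
      fderiv ℝ φ x (c • m x) + fderiv ℝ φ x p) := by
    refine integral_congr_ae ?_
    filter_upwards [hae] with x hx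
    rw [← hx, map_add, map_add]
  have h2 : ∫ x in Ω, fderiv ℝ φ x (c • m x) = 0 := by
    simp only [map_smul, smul_eq_mul]
    rw [integral_const_mul, hdiv φ, mul_zero]
  have h3 : ∫ x in Ω, fderiv ℝ φ x p = 0 := by
    rw [setIntegral_eq_integral_of_forall_compl_eq_zero fun x hx => by
      rw [fderiv_eq_zero_of_notMem φ hx, zero_apply]]
    rw [integral_fderiv_apply_eq_neg (φ.contDiff.of_le (by exact_mod_cast le_top))
      φ.hasCompactSupport contDiff_const]
    simp
  have j1 := integrable_fderiv_apply φ i1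
  have j2 := integrable_fderiv_apply φ i2
  have j3 := integrable_fderiv_apply φ i3
  have j12 : Integrable (fun x => fderiv ℝ φ x (F (m x)) + fderiv ℝ φ x (c • m x))
    (volume.restrict (Ω : Set Plane)) := j1.add j2
  rw [h1, integral_add j12 j3, integral_add j1 j2, h2, h3, add_zero, add_zero]

lemma exists_bound_deriv_coeff {γ : ℝ → Plane} {Φ : Plane → Plane} {lam : ℝ → ℝ}
    (h : IsEntropyWith γ Φ lam) : ∃ Λ, ∀ θ, |deriv lam θ| ≤ Λ := by
  have hc : Continuous (deriv lam) := h.contDiff_coeff.continuous_deriv le_rfl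
  obtain ⟨Λ, hΛ⟩ := (isCompact_Icc (a := 0) (b := 2 * Real.pi)).exists_bound_of_continuousOn
    hc.continuousOn
  have hper : Function.Periodic (deriv lam) (2 * Real.pi) := by
    intro θ
    rw [← deriv_comp_add_const]
    congr 1
    exact funext h.periodic_coeff
  refine ⟨Λ, fun θ => ?_⟩
  obtain ⟨t, ht, k, rfl⟩ := exists_mem_Ico_two_pi θ
  rw [hper.int_mul k t]
  exact hΛ t ⟨ht.1, ht.2.le⟩

end Limit

theorem proposition1p2 (N : Seminorm ℝ Plane) (hN : IsStrictlyConvexC1Norm N) :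
    ∃ C₀ : ℝ, 0 < C₀ ∧
      ∀ (γ : ℝ → Plane), IsArcLengthParam N γ →
      ∀ (Ω : Opens Plane), Bornology.IsBounded (Ω : Set Plane) →
      ∀ (m : Plane → Plane) (v : ℕ → Plane → Plane) (G : ℕ → Fin 2 → Plane → Plane) (ε : ℕ → ℝ),
        (∀ n, 0 < ε n) → Tendsto ε atTop (𝓝 0) →
        (∀ n, IsW12 Ω (v n) (G n)) →
        (∀ n, DivFree Ω (v n)) →
        (⨆ n, energy N (ε n) (v n) (G n) Ω) < ∞ →
        MemLp m 2 (volume.restrict (Ω : Set Plane)) →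
        Tendsto (fun n => eLpNorm (v n - m) 2 (volume.restrict (Ω : Set Plane))) atTop (𝓝 0) →
        SolvesEikonal N Ω m ∧
        (∀ Φ ∈ ENT γ, ∃ μ : SignedMeasure Plane, DivEqMeasure Ω (fun x => Φ (m x)) μ) ∧
        ∀ U : Opens Plane, U ≤ Ω →
          lubEntropyProduction γ Ω m U ≤
            ENNReal.ofReal C₀ * liminf (fun n => energy N (ε n) (v n) (G n) U) atTop := by
  obtain ⟨K, hK, hext⟩ := IsEntropyWith.exists_extension hN
  refine ⟨K, hK, fun γ hγ Ω hΩb m v G ε hε hε0 hv hdiv hE hm hlim => ?_⟩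
  have hΩ : volume (Ω : Set Plane) ≠ ∞ := hΩb.measure_lt_top.ne
  have hvm := fun n => (hv n).memLp
  have hm1 := ae_map_eq_one_of_tendsto hε hε0 hvm hm hlim hE
  have hmdiv := divFree_of_tendsto hΩ hvm hm hlim hdiv
  set M := ⨆ n, energy N (ε n) (v n) (G n) Ω with hM
  have hEn : ∀ n, energy N (ε n) (v n) (G n) Ω ≤ M :=
    le_iSup (fun n => energy N (ε n) (v n) (G n) Ω)
  -- the entropy productions are bounded by every weak limit of the energy densities
  have hbound : ∀ (𝓤 : Ultrafilter ℕ), (𝓤 : Filter ℕ) ≤ atTop → ∀ ν : Measure Plane,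
      (∀ f : Plane → ℝ, Continuous f → HasCompactSupport f →
        Tendsto (fun n => ∫ x, f x ∂energyMeasure N Ω (ε n) (v n) (G n)) 𝓤 (𝓝 (∫ x, f x ∂ν))) →
      ∀ Φ lam Λ, IsEntropyWith γ Φ lam → (∀ θ, |deriv lam θ| ≤ Λ) →
      Integrable (fun x => Φ (m x)) (volume.restrict (Ω : Set Plane)) ∧
      ∀ φ : 𝓓(Ω, ℝ), |∫ x in Ω, fderiv ℝ φ x (Φ (m x))| ≤ K * Λ * ∫ x, |φ x| ∂ν := by
    intro 𝓤 h𝓤 ν hν Φ lam Λ hΦ hΛ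
    have hΛ0 : 0 ≤ Λ := (abs_nonneg _).trans (hΛ 0)
    obtain ⟨F, α, c, p, hF, hFc, hFΦ, hα⟩ := hext γ hγ Φ lam Λ hΦ hΛ
    obtain ⟨hi, heq⟩ := integral_fderiv_entropy_eq hΩ hm hm1 hmdiv hF hFc hFΦ
    refine ⟨hi, fun φ => ?_⟩
    rw [heq φ]
    obtain ⟨L, hL⟩ := hF.lipschitzWith_of_hasCompactSupport hFc one_ne_zero
    have h1 := ((tendsto_integral_fderiv_comp hΩ hvm hm hlim hL φ).mono_left h𝓤).abs
    have h2 := (hν (fun x => |φ x|) φ.continuous.abs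
      (φ.hasCompactSupport.comp_left abs_zero)).const_mul (K * Λ)
    exact le_of_tendsto_of_tendsto' h1 h2 fun n =>
      abs_integral_fderiv_comp_le_energyMeasure hΩ (hε n) (hv n) (hdiv n)
        ((hEn n).trans_lt hE) hF hFc (by positivity) hα φ
  have hweak := fun 𝓤 : Ultrafilter ℕ => exists_weak_limit 𝓤
    (fun n => energyMeasure N Ω (ε n) (v n) (G n)) hE.ne
    fun n => (energyMeasure_univ Ω (ε n) (v n) (G n)).trans_le (hEn n)
  refine ⟨⟨hm1, hmdiv⟩, ?_, fun U hU => ?_⟩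
  · rintro Φ ⟨lam, hΦ⟩
    obtain ⟨Λ, hΛ⟩ := exists_bound_deriv_coeff hΦ
    obtain ⟨ν, hνfin, hν, -⟩ := hweak (Ultrafilter.of atTop)
    obtain ⟨hi, hb⟩ := hbound _ (Ultrafilter.of_le atTop) ν hν Φ lam Λ hΦ hΛ
    have hi' := fun φ : 𝓓(Ω, ℝ) => integrable_fderiv_apply φ hi
    have hdφ : ∀ (φ : 𝓓(Ω, ℝ)) x, DifferentiableAt ℝ φ x := fun φ x =>
      φ.contDiff.differentiable (by simp) x
    let T : 𝓓(Ω, ℝ) →ₗ[ℝ] ℝ :=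
      { toFun := fun φ => -∫ x in Ω, fderiv ℝ φ x (Φ (m x))
        map_add' := fun φ ψ => by
          rw [← neg_add, ← integral_add (hi' φ) (hi' ψ)]
          congr 2 with x
          rw [FunLike.coe_add, fderiv_add (hdφ φ x) (hdφ ψ x), add_apply]
        map_smul' := fun c φ => by
          rw [RingHom.id_apply, smul_eq_mul, mul_neg, ← integral_const_mul]
          congr 2 with x
          rw [FunLike.coe_smul, fderiv_const_smul (hdφ φ x), smul_apply, smul_eq_mul] }
    exact exists_signedMeasure_of_abs_le T fun φ => (abs_neg _).trans_le (hb φ)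
  · -- it suffices to bound by `c` for every `c` larger than the lower limit
    have hKpos : ENNReal.ofReal K ≠ 0 := by simpa using hK
    rw [mul_comm, ← ENNReal.div_le_iff hKpos ENNReal.ofReal_ne_top]
    refine le_of_forall_gt_imp_ge_of_dense fun c hc => ?_
    rcases eq_or_ne c ∞ with rfl | hct
    · exact le_top
    rw [ENNReal.div_le_iff hKpos ENNReal.ofReal_ne_top, mul_comm]
    have hfreq : ∃ᶠ n in atTop, energy N (ε n) (v n) (G n) U < c :=
      frequently_lt_of_liminf_lt (by isBoundedDefault) hc
    -- an ultrafilter along which the energy on `U` is less than `c`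
    have hne : (atTop ⊓ 𝓟 {n | energy N (ε n) (v n) (G n) U < c}).NeBot :=
      frequently_mem_iff_neBot.1 hfreq
    set 𝓤 := Ultrafilter.of (atTop ⊓ 𝓟 {n | energy N (ε n) (v n) (G n) U < c})
    have h𝓤 := Ultrafilter.of_le (atTop ⊓ 𝓟 {n | energy N (ε n) (v n) (G n) U < c})
    obtain ⟨ν, hνfin, hν, hνU⟩ := hweak 𝓤
    have hνc : ν U ≤ c := by
      refine hνU U U.isOpen c hct ?_
      filter_upwards [le_principal_iff.1 (h𝓤.trans inf_le_right)] with n hn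
      rw [energyMeasure_apply Ω U hU]
      exact le_of_lt hn
    have hfin : IsFiniteMeasure (ENNReal.ofReal K • ν) := ν.smul_finite ENNReal.ofReal_ne_top
    calc lubEntropyProduction γ Ω m U ≤ (ENNReal.ofReal K • ν) U := by
          refine sSup_measure_apply_le U.isOpen.measurableSet ?_
          rintro _ ⟨Φ, ⟨lam, hΦ, hΛ⟩, μ, ⟨-, hμ⟩, rfl⟩
          refine (Measure.restrict_mono hU le_rfl).trans
            (totalVariation_restrict_le (Ω := Ω) fun φ => ?_)
          obtain ⟨-, hb⟩ := hbound 𝓤 (h𝓤.trans inf_le_left) ν hν Φ lam 1 hΦ hΛ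
          rw [← hμ φ, abs_neg, integral_smul_measure, ENNReal.toReal_ofReal hK.le, smul_eq_mul]
          simpa using hb φ
      _ = ENNReal.ofReal K * ν U := by simp
      _ ≤ ENNReal.ofReal K * c := by gcongr
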